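/- Let $\mathbb{K}$ be a field of characteristic $0$ and let $H_{CK}=\mathbb{K}[\mathcal{T}]$ be the Connes–Kreimer Hopf algebra of (non-plane) rooted trees, with coproduct $\Delta(t)=t\otimes 1+1\otimes t+\sum_c P^c(t)\otimes R^c(t)$, the sum over the non-empty admissible cuts $c$ of $t$, where $R^c(t)$ is the component of $t$ containing the root after the cut and $P^c(t)$ is the forest of the other components. Let $B_+$ be the linear add-a-root operator on $H_{CK}$. Let $\mathcal{S}eq$ be the set of sequences $(t_n)_{n\ge1}$ in $H_{CK}$ such that each $t_n$ is a nonzero linear combination of trees with $n$ vertices, $t_1=\bullet$, and the subalgebra generated by the $t_n$ is a Hopf subalgebra. Feynman rules are Hopf algebra morphisms $\phi:H_{CK}\to\mathbb{K}[L]$, where $L$ is primitive. The Green function of $(t_n)$ is $G(x,L)=1+\sum_{n\ge1}\phi(t_n)x^n$. A sequence in $\mathcal{S}eq$ is *strong $0$th order* if for every choice of Feynman rules $\phi$ there are power series $\beta(x)=\sum_{i\ge1}\beta_ix^i$ and $\gamma_0(x)$ over $\mathbb{K}$ with $$\frac{\partial G}{\partial L}=\beta(x)\,G+\gamma_0(x),$$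 and with $\beta_1\neq0$ whenever $\phi(\bullet)\ne0$. Let $\ell_0=1$ and $\ell_{k+1}=B_+(\ell_k)$, so that $\ell_k$ is the ladder with $k$ vertices, and let $$p_k=\sum_{r=1}^{k}\ \sum_{\substack{j_1+\dots+j_r=k\\ j_1,\dots,j_r\ge1}}\frac{(-1)^{r+1}}{r}\,\ell_{j_1}\cdots\ell_{j_r}\qquad(k\ge1)$$ be the homogeneous components of $\ln\bigl(1+\sum_{k\ge1}\ell_k\bigr)$. For $n\ge1$ and $b\in\mathbb{K}\setminus\{0\}$ let $Z_n(b)$ be the sequence of homogeneous components (of degrees $1,2,\dots$) of $B_+\bigl(\exp(p_1+\dots+p_{n-1}+b\,p_n)\bigr)$. **Theorem.** 1. A sequence $(t_n)_{n\ge1}$ in $H_{CK}$ is strong $0$th order if and only if, up to rescaling, it is the sequence of ladders or one of the sequences $Z_n(b)$; that is, if and only if there is $\alpha\in\mathbb{K}\setminus\{0\}$ such that either $t_k=\alpha^{k-1}\ell_k$ for all $k\ge1$, or there are $n\ge1$ and $b\neq0$ such that $t_k=\alpha^{k-1}z_k$ for all $k\ge1$, where $(z_k)_{k\ge1}=Z_n(b)$.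 2. Let $\Lambda$ be the set of arrays $(\lambda_{i,j})_{i,j\ge1}$ in $\mathbb{K}$ such that $$\lambda_{i,j}\lambda_{i+j,k}-\lambda_{j,k}\lambda_{i,j+k}=\lambda_{i,k}\lambda_{i+k,j}-\lambda_{k,j}\lambda_{i,j+k}\qquad\text{for all } i,j,k\ge1$$ and such that for each $n\ge2$ there are $i,j\ge1$ with $i+j=n$ and $\lambda_{i,j}\ne0$. An array $(\lambda_{i,j})$ lies in $\Lambda$ and is such that for each $j$ the sequence $(\lambda_{i,j})_{i\ge1}$ is constant if and only if there is a scalar $c\neq0$ such that either $\lambda_{i,j}=c$ for all $i,j$, or there are $n\ge2$ and $b\in\mathbb{K}\setminus\{1\}$ such that, for all $i,j$, $\lambda_{i,j}=c$ if $j<n$, $\lambda_{i,j}=cb$ if $j=n$, and $\lambda_{i,j}=0$ if $j>n$. (The normalization $\lambda_{1,1}=1$ is the case $c=1$.) -/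

import Mathlib

open scoped TensorProduct

namespace CK

/-! ## Rooted trees

Every rooted tree is obtained from the one-vertex tree by repeatedly attaching a further subtree to
the root. Non-plane rooted trees are plane ones up to the order in which the subtrees are attached,
at every vertex. -/

/-- Plane rooted trees: `leaf` is a single vertex; `graft c t` is `t` with one additional
subtree `c` below its root, that is, the roots of `c` and `t` are joined by a new edge and the
root of `t` remains the root. -/
inductive PlaneTree : Type
  | leaf : PlaneTree
  | graft (c t : PlaneTree) : PlaneTree

/-- Exchange of two adjacent child subtrees of some vertex. -/
inductive PlaneTree.Swap : PlaneTree → PlaneTree → Prop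
  | swap (a b t : PlaneTree) : Swap (.graft a (.graft b t)) (.graft b (.graft a t))
  | inChild {a a' : PlaneTree} (t : PlaneTree) : Swap a a' → Swap (.graft a t) (.graft a' t)
  | inRest (a : PlaneTree) {t t' : PlaneTree} : Swap t t' → Swap (.graft a t) (.graft a t')

/-- Non-empty rooted trees without plane structure. -/
def RTree : Type := Quot PlaneTree.Swap

namespace RTree

/-- The one-vertex tree. -/
def leaf : RTree := Quot.mk _ PlaneTree.leaf

/-- Attach `c` as an additional child subtree of the root of `t`. -/
def graft (c t : RTree) : RTree :=
  Quot.map₂ PlaneTree.graft (fun a _ _ h => PlaneTree.Swap.inRest a h)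
    (fun _ _ t h => PlaneTree.Swap.inChild t h) c t

theorem graft_left_comm (a b t : RTree) : graft a (graft b t) = graft b (graft a t) := by
  induction a using Quot.ind
  induction b using Quot.ind
  induction t using Quot.ind
  exact Quot.sound (PlaneTree.Swap.swap _ _ _)

instance : LeftCommutative graft := ⟨graft_left_comm⟩

@[elab_as_elim]
theorem induct {P : RTree → Prop} (hl : P leaf)
    (hg : ∀ c t, P c → P t → P (graft c t)) (t : RTree) : P t := by
  induction t using Quot.ind with
  | mk t =>
    induction t with
    | leaf => exact hl
    | graft c t hc ht => exact hg _ _ hc ht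

/-- The tree whose root has the forest `F` as its multiset of child subtrees. -/
def node (F : Multiset RTree) : RTree := F.foldr graft leaf

end RTree

/-- Number of vertices of a plane tree. -/
def PlaneTree.size : PlaneTree → ℕ
  | .leaf => 1
  | .graft c t => c.size + t.size

/-- Number of vertices of a rooted tree. -/
def RTree.size : RTree → ℕ :=
  Quot.lift PlaneTree.size (by
    intro s t h
    induction h with
    | swap a b t => simp only [PlaneTree.size]; omega
    | inChild t _ ih => simp only [PlaneTree.size, ih]
    | inRest a _ ih => simp only [PlaneTree.size, ih])

@[simp] theorem RTree.size_leaf : RTree.leaf.size = 1 := rfl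

@[simp] theorem RTree.size_graft (c t : RTree) : (RTree.graft c t).size = c.size + t.size := by
  induction c using Quot.ind
  induction t using Quot.ind
  rfl

/-! ## Admissible cuts

An admissible cut is a set of edges with at most one edge on every path from the root to a leaf.
A cut of `graft c t` restricts to a cut of `t`, and either contains the edge joining the two
roots, and then no edge of `c`, or does not contain it, and then restricts to a cut of `c`. -/

/-- One step of the enumeration of cuts: from the pairs `(P, R)` of the cuts of `c` and a pair
`q` of a cut of `t`, the pairs of the corresponding cuts of `graft c t`. -/
def cutStep (c : RTree) (M : Multiset (Multiset RTree × RTree)) (q : Multiset RTree × RTree) :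
    Multiset (Multiset RTree × RTree) :=
  (c ::ₘ q.1, q.2) ::ₘ M.map fun p => (p.1 + q.1, RTree.graft p.2 q.2)

theorem cutStep_comm (a b : RTree) (A B : Multiset (Multiset RTree × RTree))
    (q : Multiset RTree × RTree) :
    (cutStep b B q).bind (cutStep a A) = (cutStep a A q).bind (cutStep b B) := by
  simp only [cutStep, Multiset.cons_bind, Multiset.bind_map, Multiset.bind_cons,
    Multiset.cons_add, Multiset.add_cons]
  rw [Multiset.cons_swap, Multiset.bind_map_comm]
  simp only [Multiset.cons_swap b a, RTree.graft_left_comm, add_left_comm]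

/-- The multiset of pairs `(P^c, R^c)`, for `c` running over all admissible cuts of the tree,
the empty cut included: `R^c` is the component of the root after removing the edges in `c`, and
`P^c` is the forest of the other components. -/
def PlaneTree.cuts : PlaneTree → Multiset (Multiset RTree × RTree)
  | .leaf => {(0, RTree.leaf)}
  | .graft c t => t.cuts.bind (cutStep (Quot.mk _ c) c.cuts)

/-- The multiset of pairs `(P^c, R^c)` over all admissible cuts `c` of a rooted tree, the empty
cut, with pair `(0, t)`, included. -/
def RTree.cuts : RTree → Multiset (Multiset RTree × RTree) :=
  Quot.lift PlaneTree.cuts (by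
    intro s t h
    induction h with
    | swap a b t =>
      simp only [PlaneTree.cuts, Multiset.bind_assoc]
      exact Multiset.bind_congr fun q _ => cutStep_comm _ _ _ _ q
    | inChild t h ih => simp only [PlaneTree.cuts, ih, Quot.sound h]
    | inRest a _ ih => simp only [PlaneTree.cuts, ih])

theorem RTree.cuts_leaf : RTree.leaf.cuts = {(0, RTree.leaf)} := rfl

theorem RTree.cuts_graft (c t : RTree) :
    (RTree.graft c t).cuts = t.cuts.bind (cutStep c c.cuts) := by
  induction c using Quot.ind
  induction t using Quot.ind
  rfl

theorem RTree.size_add_of_mem_cuts (t : RTree) :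
    ∀ q ∈ t.cuts, (q.1.map RTree.size).sum + q.2.size = t.size := by
  induction t using RTree.induct with
  | hl => simp [RTree.cuts_leaf]
  | hg c t hc ht =>
    intro q hq
    simp only [RTree.cuts_graft, Multiset.mem_bind, cutStep, Multiset.mem_cons,
      Multiset.mem_map] at hq
    obtain ⟨r, hr, rfl | ⟨p, hp, rfl⟩⟩ := hq
    · have := ht r hr
      simp only [Multiset.map_cons, Multiset.sum_cons, RTree.size_graft]
      omega
    · have h1 := ht r hr
      have h2 := hc p hp
      simp only [Multiset.map_add, Multiset.sum_add, RTree.size_graft]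
      omega

theorem RTree.size_pos (t : RTree) : 0 < t.size := by
  induction t using RTree.induct with
  | hl => simp
  | hg c t hc ht => simp only [RTree.size_graft]; omega

theorem RTree.size_lt_of_mem_cuts {t : RTree} {q : Multiset RTree × RTree} (hq : q ∈ t.cuts)
    {s : RTree} (hs : s ∈ q.1) : s.size < t.size := by
  have h1 := t.size_add_of_mem_cuts q hq
  have h2 := q.2.size_pos
  have h3 : s.size ≤ (q.1.map RTree.size).sum :=
    Multiset.single_le_sum (fun _ _ => Nat.zero_le _) _ (Multiset.mem_map_of_mem _ hs)
  omega

noncomputable section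

/-! ## The Connes–Kreimer Hopf algebra -/

variable (K : Type*) [Field K]

/-- The underlying algebra: polynomials in the rooted trees. Monomials are forests. -/
abbrev HCK : Type _ := MvPolynomial RTree K

/-- A forest as a monomial. -/
def forest (F : Multiset RTree) : HCK K := (F.map fun t => MvPolynomial.X t).prod

/-- The coproduct: the algebra morphism with
`Δ t = t ⊗ 1 + 1 ⊗ t + ∑ P^c ⊗ R^c` over the non-empty admissible cuts `c` of the tree `t`
(the term `1 ⊗ t` is the contribution of the empty cut). -/
def comul : HCK K →ₐ[K] HCK K ⊗[K] HCK K :=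
  MvPolynomial.aeval fun t =>
    MvPolynomial.X t ⊗ₜ[K] 1 + (t.cuts.map fun q => forest K q.1 ⊗ₜ[K] MvPolynomial.X q.2).sum

/-- The counit: the algebra morphism vanishing on all trees. -/
def counit : HCK K →ₐ[K] K := MvPolynomial.aeval fun _ => 0

/-- The antipode on trees: `S t = - t - ∑ S(P^c) R^c` over the non-empty admissible cuts `c`, with
`S` multiplicative (the term `- t` is the contribution of the empty cut). -/
def antipodeTree (t : RTree) : HCK K :=
  -(t.cuts.attach.map fun q =>
    (q.1.1.attach.map fun s => antipodeTree s.1).prod * MvPolynomial.X q.1.2).sum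
termination_by t.size
decreasing_by exact RTree.size_lt_of_mem_cuts q.2 s.2

theorem antipodeTree_eq (t : RTree) :
    antipodeTree K t =
      -(t.cuts.map fun q => (q.1.map (antipodeTree K)).prod * MvPolynomial.X q.2).sum := by
  rw [antipodeTree]
  simp only [Multiset.attach_map_val' _ (antipodeTree K)]
  rw [Multiset.attach_map_val' t.cuts
    fun q => (q.1.map (antipodeTree K)).prod * MvPolynomial.X q.2]

/-- The antipode. -/
def antipode : HCK K →ₐ[K] HCK K := MvPolynomial.aeval (antipodeTree K)

/-- The add-a-root operator: the linear map which sends a forest to the tree with a new root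
whose children are the roots of the trees in the forest. -/
def addRoot : HCK K →ₗ[K] HCK K :=
  (MvPolynomial.basisMonomials RTree K).constr K fun m =>
    MvPolynomial.X (RTree.node (Finsupp.toMultiset m))

variable {K}

/-- A subalgebra is a Hopf subalgebra if it is stable under the coproduct and the antipode. -/
def IsHopfSubalgebra (A : Subalgebra K (HCK K)) : Prop :=
  (∀ a ∈ A, comul K a ∈ (Algebra.TensorProduct.map A.val A.val).range) ∧
    ∀ a ∈ A, antipode K a ∈ A

/-- The set `𝒮eq` of sequences `(t_n)_{n ≥ 1}`: `t_n` is a nonzero linear combination of trees with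
`n` vertices, `t_1` is the one-vertex tree, and the `t_n` generate a Hopf subalgebra. -/
structure IsSeq (t : ℕ+ → HCK K) : Prop where
  ne_zero : ∀ n, t n ≠ 0
  mem_span : ∀ n : ℕ+, t n ∈ Submodule.span K
    {x : HCK K | ∃ s : RTree, s.size = n ∧ x = MvPolynomial.X s}
  one : t 1 = MvPolynomial.X RTree.leaf
  hopf : IsHopfSubalgebra (Algebra.adjoin K (Set.range t))

/-! ## Feynman rules and renormalization group equations -/

variable (K) in
/-- The coproduct of `K[L]`, with `Δ L = L ⊗ 1 + 1 ⊗ L`. -/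
def polyComul : Polynomial K →ₐ[K] Polynomial K ⊗[K] Polynomial K :=
  Polynomial.aeval (Polynomial.X ⊗ₜ[K] 1 + 1 ⊗ₜ[K] Polynomial.X)

variable (K) in
/-- The counit of `K[L]`, with `L ↦ 0`. -/
def polyCounit : Polynomial K →ₐ[K] K := Polynomial.aeval 0

/-- Feynman rules: a morphism of Hopf algebras from the Connes–Kreimer Hopf algebra to `K[L]`, that
is, an algebra morphism compatible with coproducts and counits (compatibility with antipodes is
automatic). -/
structure IsFeynmanRules (φ : HCK K →ₐ[K] Polynomial K) : Prop where
  comul : (Algebra.TensorProduct.map φ φ).comp (CK.comul K) = (polyComul K).comp φ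
  counit : (polyCounit K).comp φ = CK.counit K

/-- The Green function `G(x, L) = 1 + ∑_{n ≥ 1} φ(t_n) xⁿ`, as a power series in `x` with
coefficients in `K[L]`. -/
def green (φ : HCK K →ₐ[K] Polynomial K) (t : ℕ+ → HCK K) : PowerSeries (Polynomial K) :=
  PowerSeries.mk fun n => if h : 0 < n then φ (t ⟨n, h⟩) else 1

/-- The derivative with respect to `L`. -/
def derivL (G : PowerSeries (Polynomial K)) : PowerSeries (Polynomial K) :=
  PowerSeries.mk fun n => Polynomial.derivative (PowerSeries.coeff n G)

/-- A power series in `x` regarded as a power series in `x` and `L`. -/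
def constL (f : PowerSeries K) : PowerSeries (Polynomial K) :=
  PowerSeries.map Polynomial.C f

/-- The generalized renormalization group equation
`∂G/∂L = ∑_{j ≤ k} β^{(j)}(x) ∂^j G/∂x^j + γ₀(x)`,
with `β^{(j)}(x) = ∑_{i ≥ 1} β^{(j)}_i x^{i+j}`. -/
def SatisfiesRGE (k : ℕ) (β : ℕ → PowerSeries K) (γ₀ : PowerSeries K)
    (G : PowerSeries (Polynomial K)) : Prop :=
  (∀ j ≤ k, (PowerSeries.X : PowerSeries K) ^ (j + 1) ∣ β j) ∧
    derivL G = ∑ j ∈ Finset.range (k + 1),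
      constL (β j) * (PowerSeries.derivative (Polynomial K))^[j] G + constL γ₀

/-- Strong `k`-th order sequences: elements of `𝒮eq` whose Green function satisfies a generalized
renormalization group equation of order `k` for every choice of Feynman rules `φ`; the equation has
`β^{(k)}_1 ≠ 0` (so its order is exactly `k`) whenever `φ` does not vanish on the one-vertex tree.
Here `β^{(k)}_1` is the coefficient of `x^{k+1}` in `β^{(k)}`. -/
def IsStrong (k : ℕ) (t : ℕ+ → HCK K) : Prop :=
  IsSeq t ∧ ∀ φ : HCK K →ₐ[K] Polynomial K, IsFeynmanRules φ →
    ∃ (β : ℕ → PowerSeries K) (γ₀ : PowerSeries K),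
      SatisfiesRGE k β γ₀ (green φ t) ∧
        (φ (MvPolynomial.X RTree.leaf) ≠ 0 → PowerSeries.coeff (k + 1) (β k) ≠ 0)

/-! ## Arrays -/

/-- The set `Λ` of arrays `(λ_{i,j})_{i,j ≥ 1}` satisfying the pre-Lie relation and
non-degeneracy. -/
structure IsLambdaArray (lam : ℕ+ → ℕ+ → K) : Prop where
  preLie : ∀ i j k, lam i j * lam (i + j) k - lam j k * lam i (j + k) =
    lam i k * lam (i + k) j - lam k j * lam i (j + k)
  nondegenerate : ∀ n : ℕ+, 2 ≤ n → ∃ i j, i + j = n ∧ lam i j ≠ 0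

/-! ## Ladders, the primitive elements `p_n`, and the sequences `Z_n(b)` -/

variable (K) in
/-- The ladder with `n` vertices; `ℓ_0 = 1`. -/
def ladder : ℕ → HCK K
  | 0 => 1
  | n + 1 => addRoot K (ladder n)

variable (K) in
/-- For `n ≥ 1`, the degree `n` component of `ln(1 + ∑_{k ≥ 1} ℓ_k)`, that is, the sum over all
compositions `(j_1, …, j_k)` of `n` of `(-1)^{k+1}/k ⋅ ℓ_{j_1} ⋯ ℓ_{j_k}`. -/
def ladderLog (n : ℕ) : HCK K :=
  ∑ c : Composition n,
    ((-1 : K) ^ (c.length + 1) / (c.length : K)) • (c.blocks.map (ladder K)).prod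

/-- `p_1 + … + p_{n-1} + b p_n`, the variable of the power series recording the degree. -/
def zExponent (n : ℕ+) (b : K) : PowerSeries (HCK K) :=
  ∑ k ∈ Finset.Ico 1 (n : ℕ), PowerSeries.monomial k (ladderLog K k) +
    PowerSeries.monomial (n : ℕ) (b • ladderLog K n)

/-- The sequence of homogeneous components of
`Z_n(b) = B_+(exp(p_1 + … + p_{n-1} + b p_n))`; the component of degree `k` is the image under
`B_+` of the component of degree `k - 1` of the exponential. -/
def zSeq [CharZero K] (n : ℕ+) (b : K) (k : ℕ+) : HCK K :=
  addRoot K (PowerSeries.coeff ((k : ℕ) - 1) ((PowerSeries.exp K).subst (zExponent n b)))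

/-- The rescaling `(α^{n-1} t_n)_{n ≥ 1}` of a sequence. -/
def rescaleSeq (α : K) (t : ℕ+ → HCK K) (n : ℕ+) : HCK K := α ^ ((n : ℕ) - 1) • t n

end

end CK

namespace CK

open RTree
open Finset.HasAntidiagonal (antidiagonal mem_antidiagonal)

variable {K : Type*} [Field K]

/-! ## Forests and the add-a-root operator -/

/-! Two facts drive the proof: the cocycle identity Δ B₊ = B₊ ⊗ 1 + (id ⊗ B₊) Δ (`comul_addRoot`),
and the correspondence between Feynman rules and infinitesimal characters. If δ(x) is the
coefficient of L in φ(x), then ∂φ/∂L = φ ∘ (δ ⊗ id) Δ (`IsFeynmanRules.derivative`). Conversely, any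
values d on trees integrate to Feynman rules (`isFeynmanRules_feynman`).

Sufficiency. Let ∑ x_n be group-like with x_n homogeneous of degree n, x_1 a nonzero multiple of the
vertex, and every x_n in the algebra generated by the t_{n+1} = B₊(x_n). The cocycle identity gives
Δ t_{n+1} = t_{n+1} ⊗ 1 + ∑ x_p ⊗ t_{q+1} over p + q = n. This yields both the Hopf subalgebra and
the equation with β_n = δ(x_n) (`IsGenerating.isStrong`). The ladders and the components of exp(p_1
+ … + b p_n) are such sequences, because the p_k are primitive.

Necessity. In general Δ t_{n+1} = t_{n+1} ⊗ 1 + ∑ c_{p,q} ⊗ t_{q+1}, where the linear part of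
c_{n+1,k} is a multiple of t_{n+1} (`DualSeq.comul_eq`, `DualSeq.linPart_of_mem`). Testing against
Feynman rules with δ(t_n) = 1 for all n makes φ(t_n) of degree exactly n, so coefficients can be
compared: that multiple is some λ_{n+1} independent of k (`DualSeq.exists_linPart_coeff_eq`). A
commutator of infinitesimal characters then forces (λ_i - λ_j) λ_{i+j} = 0
(`DualSeq.sub_mul_eq_zero`), whose solutions with λ_1 ≠ 0 are c(1, 1, …) and c(1, …, 1, b, 0, …)
(`eq_const_or_truncSeq`).

These numbers determine the sequence: by induction c_{n,k} differs from the model x_n by a primitive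
element without linear part, and such an element is zero in characteristic 0
(`eq_zero_of_primitive_of_linPart_eq_zero`).

For an array constant in its first index the pre-Lie relation is the same equation on λ, so the
second statement is the same classification. -/

@[simp] theorem forest_zero : forest K 0 = 1 := rfl

@[simp] theorem forest_cons (t : RTree) (F : Multiset RTree) :
    forest K (t ::ₘ F) = MvPolynomial.X t * forest K F := by simp [forest]

@[simp] theorem forest_singleton (t : RTree) : forest K {t} = MvPolynomial.X t := by
  simp [forest]

theorem forest_add (F G : Multiset RTree) : forest K (F + G) = forest K F * forest K G := by
  simp [forest]

theorem monomial_eq_forest (m : RTree →₀ ℕ) :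
    MvPolynomial.monomial m (1 : K) = forest K (Finsupp.toMultiset m) := by
  classical
  rw [MvPolynomial.monomial_eq, forest, Finsupp.toMultiset_map, Finsupp.prod_toMultiset,
    Finsupp.prod_mapDomain_index (by simp) (by intros; rw [pow_add])]
  simp

theorem basisMonomials_eq_forest (m : RTree →₀ ℕ) :
    MvPolynomial.basisMonomials RTree K m = forest K (Finsupp.toMultiset m) := by
  exact (congrFun (MvPolynomial.coe_basisMonomials RTree K) m).trans (monomial_eq_forest m)

theorem forest_eq_basisMonomials [DecidableEq RTree] (F : Multiset RTree) :
    forest K F = MvPolynomial.basisMonomials RTree K (Multiset.toFinsupp F) := by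
  rw [basisMonomials_eq_forest, Multiset.toFinsupp_toMultiset]

theorem linearMap_ext_forest {M : Type*} [AddCommMonoid M] [Module K M] {f g : HCK K →ₗ[K] M}
    (h : ∀ F, f (forest K F) = g (forest K F)) : f = g :=
  (MvPolynomial.basisMonomials RTree K).ext fun m => by rw [basisMonomials_eq_forest, h]

@[simp] theorem addRoot_forest (F : Multiset RTree) :
    addRoot K (forest K F) = MvPolynomial.X (node F) := by
  classical
  rw [forest_eq_basisMonomials, addRoot, Module.Basis.constr_basis, Multiset.toFinsupp_toMultiset]

@[simp] theorem addRoot_one : addRoot K 1 = MvPolynomial.X leaf := by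
  rw [← forest_zero, addRoot_forest]; rfl

theorem RTree.node_cons (c : RTree) (F : Multiset RTree) : node (c ::ₘ F) = graft c (node F) :=
  Multiset.foldr_cons _ _ _ _

theorem RTree.size_node (F : Multiset RTree) : (node F).size = (F.map RTree.size).sum + 1 := by
  induction F using Multiset.induction with
  | empty => rfl
  | cons c F ih => rw [node_cons, size_graft, ih]; simp; ring

theorem RTree.eq_zero_of_sum_size_eq_zero {F : Multiset RTree}
    (h : (F.map RTree.size).sum = 0) : F = 0 :=
  Multiset.eq_zero_of_forall_notMem fun s hs => by
    have h2 : s.size ≤ (F.map RTree.size).sum :=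
      Multiset.single_le_sum (fun _ _ => Nat.zero_le _) _ (Multiset.mem_map_of_mem _ hs)
    have := s.size_pos
    omega

theorem RTree.node_surjective (t : RTree) : ∃ F, t = node F := by
  induction t using RTree.induct with
  | hl => exact ⟨0, rfl⟩
  | hg c t _ ht =>
    obtain ⟨F, rfl⟩ := ht
    exact ⟨c ::ₘ F, (node_cons c F).symm⟩

/-- Every tree is B₊ of the forest of its branches, so stability under B₊ reaches all generators.
Through `algHom_ext_of_addRoot`, this lets coalgebra identities be checked along B₊ alone. -/
theorem subalgebra_eq_top_of_addRoot (E : Subalgebra K (HCK K))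
    (h : ∀ x ∈ E, addRoot K x ∈ E) : E = ⊤ := by
  have forest_mem : ∀ F : Multiset RTree, (∀ s ∈ F, MvPolynomial.X s ∈ E) → forest K F ∈ E := by
    intro F hF
    refine Subalgebra.multiset_prod_mem _ fun x hx => ?_
    obtain ⟨s, hs, rfl⟩ := Multiset.mem_map.1 hx
    exact hF s hs
  have key : ∀ t : RTree, ∃ F, t = node F ∧ ∀ s ∈ F, (MvPolynomial.X s : HCK K) ∈ E := by
    intro t
    induction t using RTree.induct with
    | hl => exact ⟨0, rfl, by simp⟩
    | hg c t hc ht =>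
      obtain ⟨F, rfl, hF⟩ := hc
      obtain ⟨G, rfl, hG⟩ := ht
      refine ⟨node F ::ₘ G, (node_cons _ G).symm, fun s hs => ?_⟩
      rcases Multiset.mem_cons.1 hs with rfl | hs
      · rw [← addRoot_forest]
        exact h _ (forest_mem F hF)
      · exact hG s hs
  rw [eq_top_iff, ← MvPolynomial.adjoin_range_X, Algebra.adjoin_le_iff]
  rintro _ ⟨t, rfl⟩
  obtain ⟨F, rfl, hF⟩ := key t
  change MvPolynomial.X (node F) ∈ E
  rw [← addRoot_forest]
  exact h _ (forest_mem F hF)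

theorem algHom_ext_of_addRoot {R : Type*} [Semiring R] [Algebra K R] {f g : HCK K →ₐ[K] R}
    (h : ∀ x, f x = g x → f (addRoot K x) = g (addRoot K x)) : f = g := by
  have := subalgebra_eq_top_of_addRoot (AlgHom.equalizer f g) (fun x hx => h x hx)
  ext t
  have ht : MvPolynomial.X t ∈ AlgHom.equalizer f g := this ▸ Algebra.mem_top
  exact ht

/-! ## The cocycle property and the coalgebra axioms -/

theorem comul_X (t : RTree) : comul K (MvPolynomial.X t) = MvPolynomial.X t ⊗ₜ[K] 1 +
    (t.cuts.map fun q => forest K q.1 ⊗ₜ[K] MvPolynomial.X q.2).sum := by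
  simp [comul]

/-- A cut below a new root chooses, for each branch, either the edge above it (the term t ⊗ 1) or a
cut inside it. This is exactly the expansion of the product of the coproducts of the branches. -/
theorem exists_cuts_node (F : Multiset RTree) : ∃ M : Multiset (Multiset RTree × Multiset RTree),
    (node F).cuts = M.map (Prod.map id node) ∧
      comul K (forest K F) = (M.map fun q => forest K q.1 ⊗ₜ[K] forest K q.2).sum := by
  induction F using Multiset.induction with
  | empty => exact ⟨{(0, 0)}, by simp [show node 0 = leaf from rfl, cuts_leaf], by
      simp [Algebra.TensorProduct.one_def]⟩
  | cons c F ih =>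
    obtain ⟨M, h1, h2⟩ := ih
    refine ⟨M.bind fun q => (c ::ₘ q.1, q.2) ::ₘ c.cuts.map fun p => (p.1 + q.1, p.2 ::ₘ q.2),
      ?_, ?_⟩
    · rw [node_cons, cuts_graft, h1, Multiset.bind_map, Multiset.map_bind]
      refine Multiset.bind_congr fun q _ => ?_
      simp [cutStep, node_cons]
    · rw [forest_cons, map_mul, h2, comul_X, Multiset.map_bind, Multiset.sum_bind,
        ← Multiset.sum_map_mul_left]
      refine congrArg Multiset.sum (Multiset.map_congr rfl fun q _ => ?_)
      rw [Multiset.map_cons, Multiset.sum_cons, add_mul, Multiset.map_map,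
        ← Multiset.sum_map_mul_right]
      simp [Algebra.TensorProduct.tmul_mul_tmul, forest_add]

/-- The Hochschild cocycle property of B₊, read off on forests from `exists_cuts_node`. -/
theorem comul_addRoot (x : HCK K) :
    comul K (addRoot K x) = addRoot K x ⊗ₜ[K] 1 + (addRoot K).lTensor (HCK K) (comul K x) := by
  suffices h : (comul K).toLinearMap ∘ₗ addRoot K =
      (TensorProduct.mk K (HCK K) (HCK K)).flip 1 ∘ₗ addRoot K +
        (addRoot K).lTensor (HCK K) ∘ₗ (comul K).toLinearMap from LinearMap.congr_fun h x
  refine linearMap_ext_forest fun F => ?_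
  obtain ⟨M, h1, h2⟩ := exists_cuts_node (K := K) F
  simp only [LinearMap.comp_apply, LinearMap.add_apply, LinearMap.flip_apply,
    TensorProduct.mk_apply, AlgHom.toLinearMap_apply, addRoot_forest, h2, comul_X, h1]
  rw [map_multiset_sum, Multiset.map_map, Multiset.map_map]
  simp [Function.comp_def]

@[simp] theorem counit_X (t : RTree) : counit K (MvPolynomial.X t) = 0 := by simp [counit]

theorem counit_forest (F : Multiset RTree) [Decidable (F = 0)] :
    counit K (forest K F) = if F = 0 then 1 else 0 := by
  split_ifs with h
  · simp [h]
  · obtain ⟨c, hc⟩ := Multiset.exists_mem_of_ne_zero h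
    obtain ⟨G, rfl⟩ := Multiset.exists_cons_of_mem hc
    simp

@[simp] theorem counit_addRoot (x : HCK K) : counit K (addRoot K x) = 0 := by
  suffices h : (counit K).toLinearMap ∘ₗ addRoot K = 0 from LinearMap.congr_fun h x
  exact linearMap_ext_forest fun F => by simp

theorem lid_counit_comp_comul :
    ((Algebra.TensorProduct.lid K (HCK K)).toAlgHom.comp
      (Algebra.TensorProduct.map (counit K) (AlgHom.id K (HCK K)))).comp (comul K) =
        AlgHom.id K (HCK K) := by
  refine algHom_ext_of_addRoot fun x hx => ?_
  simp only [AlgHom.comp_apply, AlgHom.id_apply] at hx ⊢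
  rw [comul_addRoot, map_add, map_add, Algebra.TensorProduct.map_tmul, counit_addRoot,
    TensorProduct.zero_tmul, map_zero, zero_add]
  nth_rewrite 2 [← hx]
  induction comul K x with
  | zero => simp
  | tmul a b => simp
  | add a b ha hb => simp only [map_add, ha, hb]

theorem rid_counit_comp_comul :
    ((Algebra.TensorProduct.rid K K (HCK K)).toAlgHom.comp
      (Algebra.TensorProduct.map (AlgHom.id K (HCK K)) (counit K))).comp (comul K) =
        AlgHom.id K (HCK K) := by
  refine algHom_ext_of_addRoot fun x hx => ?_
  simp only [AlgHom.comp_apply, AlgHom.id_apply]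
  rw [comul_addRoot, map_add, map_add]
  have : Algebra.TensorProduct.map (AlgHom.id K (HCK K)) (counit K)
      ((addRoot K).lTensor (HCK K) (comul K x)) = 0 := by
    induction comul K x with
    | zero => simp
    | tmul a b => simp
    | add a b ha hb => simp only [map_add, ha, hb, add_zero]
  rw [this]
  simp

theorem comul_coassoc :
    ((Algebra.TensorProduct.assoc K K K (HCK K) (HCK K) (HCK K)).toAlgHom.comp
      (Algebra.TensorProduct.map (comul K) (AlgHom.id K (HCK K)))).comp (comul K) =
    (Algebra.TensorProduct.map (AlgHom.id K (HCK K)) (comul K)).comp (comul K) := by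
  refine algHom_ext_of_addRoot fun x hx => ?_
  simp only [AlgHom.comp_apply] at hx ⊢
  have h1 : ∀ z : HCK K ⊗[K] HCK K, (Algebra.TensorProduct.assoc K K K _ _ _).toAlgHom
      (Algebra.TensorProduct.map (comul K) (AlgHom.id K (HCK K))
        ((addRoot K).lTensor (HCK K) z)) = ((addRoot K).lTensor (HCK K)).lTensor (HCK K)
      ((Algebra.TensorProduct.assoc K K K _ _ _).toAlgHom
        (Algebra.TensorProduct.map (comul K) (AlgHom.id K (HCK K)) z)) := by
    intro z
    induction z with
    | zero => simp
    | add a b ha hb => simp only [map_add, ha, hb]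
    | tmul a b =>
      simp only [LinearMap.lTensor_tmul, Algebra.TensorProduct.map_tmul, AlgHom.id_apply]
      induction comul K a with
      | zero => simp
      | add a b ha hb => simp only [TensorProduct.add_tmul, map_add, ha, hb]
      | tmul a b => simp
  have h2 : ∀ z : HCK K ⊗[K] HCK K, Algebra.TensorProduct.map (AlgHom.id K (HCK K)) (comul K)
      ((addRoot K).lTensor (HCK K) z) =
        (Algebra.TensorProduct.assoc K K K _ _ _).toAlgHom ((addRoot K).lTensor (HCK K) z ⊗ₜ[K] 1)
        + ((addRoot K).lTensor (HCK K)).lTensor (HCK K)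
          (Algebra.TensorProduct.map (AlgHom.id K (HCK K)) (comul K) z) := by
    intro z
    induction z with
    | zero => simp
    | add a b ha hb => simp only [map_add, ha, hb, TensorProduct.add_tmul]; abel
    | tmul a b => simp [comul_addRoot, TensorProduct.tmul_add]
  rw [comul_addRoot, map_add, map_add, map_add, h1, h2, hx, Algebra.TensorProduct.map_tmul,
    Algebra.TensorProduct.map_tmul, comul_addRoot, map_one, AlgHom.id_apply, map_one,
    TensorProduct.add_tmul, map_add]
  simp only [Algebra.TensorProduct.one_def, add_assoc]
  rfl

/-! ## Linear parts, infinitesimal characters and primitive elements -/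

/-- The linear map sending every tree `t` to `d t` and vanishing on all other forests. -/
noncomputable def linPart {M : Type*} [AddCommGroup M] [Module K M] (d : RTree → M) :
    HCK K →ₗ[K] M :=
  (MvPolynomial.basisMonomials RTree K).constr K fun m =>
    if (Finsupp.toMultiset m).card = 1 then ((Finsupp.toMultiset m).map d).sum else 0

section linPart

variable {M : Type*} [AddCommGroup M] [Module K M] (d : RTree → M)

theorem linPart_forest (F : Multiset RTree) :
    linPart d (forest K F) = if F.card = 1 then (F.map d).sum else 0 := by
  classical
  rw [forest_eq_basisMonomials, linPart, Module.Basis.constr_basis, Multiset.toFinsupp_toMultiset]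

@[simp] theorem linPart_X (t : RTree) : linPart d (MvPolynomial.X t : HCK K) = d t := by
  rw [← forest_singleton, linPart_forest]
  simp

@[simp] theorem linPart_one : linPart d (1 : HCK K) = 0 := by
  rw [← forest_zero, linPart_forest]
  simp

@[simp] theorem linPart_addRoot_forest (F : Multiset RTree) :
    linPart d (addRoot K (forest K F)) = d (node F) := by
  rw [addRoot_forest, linPart_X]

/-- A product of two non-empty forests is never a single tree. For scalar values this says that
`linPart d` is an infinitesimal character. -/
theorem linPart_mul (x y : HCK K) :
    linPart d (x * y) = counit K x • linPart d y + counit K y • linPart d x := by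
  classical
  suffices h : (LinearMap.mul K (HCK K)).compr₂ (linPart d) =
      (LinearMap.lsmul K M).compl₁₂ (counit K).toLinearMap (linPart d) +
        ((LinearMap.lsmul K M).compl₁₂ (counit K).toLinearMap (linPart d)).flip from
    LinearMap.congr_fun (LinearMap.congr_fun h x) y
  refine linearMap_ext_forest fun F => linearMap_ext_forest fun G => ?_
  simp only [LinearMap.compr₂_apply, LinearMap.mul_apply', LinearMap.add_apply,
    LinearMap.compl₁₂_apply, LinearMap.flip_apply, LinearMap.lsmul_apply,
    AlgHom.toLinearMap_apply, ← forest_add, counit_forest, linPart_forest]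
  rcases F.empty_or_exists_mem with rfl | ⟨a, ha⟩
  · simp
  rcases G.empty_or_exists_mem with rfl | ⟨b, hb⟩
  · simp
  have hF := Multiset.card_pos_iff_exists_mem.2 ⟨a, ha⟩
  have hG := Multiset.card_pos_iff_exists_mem.2 ⟨b, hb⟩
  rw [if_neg (c := (F + G).card = 1) (by rw [Multiset.card_add]; omega),
    if_neg (c := F = 0) (by rintro rfl; simp at ha),
    if_neg (c := G = 0) (by rintro rfl; simp at hb)]
  simp

theorem linPart_linPart_X (x : HCK K) :
    linPart d (linPart MvPolynomial.X x : HCK K) = linPart d x := by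
  suffices h : linPart d ∘ₗ linPart MvPolynomial.X = linPart d from LinearMap.congr_fun h x
  refine linearMap_ext_forest fun F => ?_
  simp only [LinearMap.comp_apply, linPart_forest]
  split_ifs with h
  · obtain ⟨t, rfl⟩ := Multiset.card_eq_one.1 h
    simp
  · simp

/-- A derivation along the counit is determined by its values on trees. This recognises brackets and
first-order coefficients of Feynman rules as infinitesimal characters. -/
theorem eq_linPart_of_map_mul {f : HCK K →ₗ[K] M}
    (hf : ∀ x y, f (x * y) = counit K x • f y + counit K y • f x) :
    f = linPart fun t => f (MvPolynomial.X t) := by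
  have h1 : f 1 = 0 := by simpa using hf 1 1
  refine linearMap_ext_forest fun F => ?_
  induction F using Multiset.induction with
  | empty => simp [h1]
  | cons c F ih => rw [forest_cons, hf, linPart_mul, ih]; simp

end linPart

theorem linPart_single (s : RTree) [DecidableEq RTree] (x : HCK K) :
    linPart (Pi.single s 1) x = MvPolynomial.coeff (Finsupp.single s 1) x := by
  suffices h : linPart (Pi.single s 1) =
      (MvPolynomial.lcoeff K (Finsupp.single s 1) : HCK K →ₗ[K] K) from LinearMap.congr_fun h x
  refine linearMap_ext_forest fun F => ?_
  rw [linPart_forest, forest_eq_basisMonomials, MvPolynomial.coe_basisMonomials]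
  simp only [MvPolynomial.lcoeff_apply, MvPolynomial.coeff_monomial]
  split_ifs with h1 h2 h2
  · rw [← Multiset.toFinsupp_singleton, EmbeddingLike.apply_eq_iff_eq] at h2
    subst h2
    simp
  · obtain ⟨t, rfl⟩ := Multiset.card_eq_one.1 h1
    rw [Multiset.map_singleton, Multiset.sum_singleton, Pi.single_apply, if_neg]
    rintro rfl
    simp at h2
  · rw [← Multiset.toFinsupp_singleton, EmbeddingLike.apply_eq_iff_eq] at h2
    subst h2
    simp at h1
  · rfl

theorem counit_eq_coeff_zero (x : HCK K) : counit K x = MvPolynomial.coeff 0 x := by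
  suffices h : (counit K).toLinearMap = MvPolynomial.lcoeff K 0 from LinearMap.congr_fun h x
  refine linearMap_ext_forest fun F => ?_
  classical
  rw [AlgHom.toLinearMap_apply, counit_forest, forest_eq_basisMonomials,
    MvPolynomial.coe_basisMonomials]
  simp [MvPolynomial.coeff_monomial]

theorem mem_sq_idealOfVars {x : HCK K} (h0 : counit K x = 0)
    (h1 : ∀ d : RTree → K, linPart d x = 0) : x ∈ MvPolynomial.idealOfVars RTree K ^ 2 := by
  classical
  rw [MvPolynomial.mem_pow_idealOfVars_iff']
  intro m hm
  rcases Nat.lt_succ_iff_lt_or_eq.1 hm with hm | hm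
  · rw [(Finsupp.degree_eq_zero_iff m).1 (by omega), ← counit_eq_coeff_zero, h0]
  · obtain ⟨s, hs⟩ : ∃ s, Finsupp.toMultiset m = {s} := by
      rw [← Multiset.card_eq_one, Finsupp.card_toMultiset, ← hm]
      rfl
    obtain rfl : m = Finsupp.single s 1 := by
      rw [← Finsupp.toMultiset_toFinsupp m, hs, Multiset.toFinsupp_singleton]
    rw [← linPart_single, h1]

theorem sub_counit_mem_idealOfVars (x : HCK K) :
    x - algebraMap K _ (counit K x) ∈ MvPolynomial.idealOfVars RTree K := by
  rw [← pow_one (MvPolynomial.idealOfVars RTree K), MvPolynomial.mem_pow_idealOfVars_iff']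
  intro m hm
  rw [(Finsupp.degree_eq_zero_iff m).1 (by omega)]
  simp [counit_eq_coeff_zero, MvPolynomial.algebraMap_eq]

/-- The square of the identity for the convolution product. -/
noncomputable def convSq (K : Type*) [Field K] : HCK K →ₐ[K] HCK K :=
  (Algebra.TensorProduct.lmul' K).comp (comul K)

theorem convSq_sub_mem_sq {x : HCK K} (hx : counit K x = 0) :
    convSq K x - 2 * x ∈ MvPolynomial.idealOfVars RTree K ^ 2 := by
  -- On a ⊗ b the expression is (a - ε(a))(b - ε(b)), a product of two elements of the augmentation
  -- ideal.
  have key : ∀ z : HCK K ⊗[K] HCK K, Algebra.TensorProduct.lmul' K z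
      - TensorProduct.lid K _ ((counit K).toLinearMap.rTensor _ z)
      - TensorProduct.rid K _ ((counit K).toLinearMap.lTensor _ z)
      + algebraMap K _ (counit K (TensorProduct.lid K _ ((counit K).toLinearMap.rTensor _ z)))
        ∈ MvPolynomial.idealOfVars RTree K ^ 2 := by
    intro z
    induction z with
    | zero => simp
    | add a b ha hb => convert add_mem ha hb using 1; simp only [map_add]; ring
    | tmul a b =>
      rw [pow_two]
      convert Ideal.mul_mem_mul (sub_counit_mem_idealOfVars a) (sub_counit_mem_idealOfVars b)
        using 1
      simp [Algebra.smul_def]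
      ring
  have h := key (comul K x)
  have h1 : TensorProduct.lid K _ ((counit K).toLinearMap.rTensor _ (comul K x)) = x :=
    DFunLike.congr_fun (lid_counit_comp_comul (K := K)) x
  have h2 : TensorProduct.rid K _ ((counit K).toLinearMap.lTensor _ (comul K x)) = x :=
    DFunLike.congr_fun (rid_counit_comp_comul (K := K)) x
  rw [h1, h2, hx, map_zero, add_zero, sub_sub, ← two_mul] at h
  exact h

theorem counit_eq_zero_of_mem_idealOfVars {x : HCK K}
    (hx : x ∈ MvPolynomial.idealOfVars RTree K) : counit K x = 0 := by
  rw [← pow_one (MvPolynomial.idealOfVars RTree K), MvPolynomial.mem_pow_idealOfVars_iff'] at hx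
  rw [counit_eq_coeff_zero, hx 0 (by simp)]

/-- With I the augmentation ideal, the algebra map `convSq` acts as 2 on I/I², hence by
multiplicativity as 2^k on I^k/I^(k+1). -/
theorem convSq_sub_mem_pow {n : ℕ} {x : HCK K}
    (hx : x ∈ MvPolynomial.idealOfVars RTree K ^ (n + 1)) :
    convSq K x - 2 ^ (n + 1) * x ∈ MvPolynomial.idealOfVars RTree K ^ (n + 2) := by
  set I := MvPolynomial.idealOfVars RTree K
  induction n generalizing x with
  | zero =>
    rw [zero_add, pow_one] at hx ⊢
    exact convSq_sub_mem_sq (counit_eq_zero_of_mem_idealOfVars hx)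
  | succ n ih =>
    rw [pow_succ] at hx
    refine Submodule.mul_induction_on hx (fun a ha b hb => ?_) fun a b ha hb => ?_
    · have h1 := ih ha
      have h2 := convSq_sub_mem_sq (counit_eq_zero_of_mem_idealOfVars hb)
      have hΨb : convSq K b ∈ I := by
        have := add_mem (Ideal.pow_le_self two_ne_zero h2) (I.mul_mem_left 2 hb)
        simpa using this
      have e1 := Ideal.mul_mem_mul h1 hΨb
      have e2 := Ideal.mul_mem_mul (Ideal.mul_mem_left _ (2 ^ (n + 1)) ha) h2
      rw [← pow_succ] at e1
      rw [← pow_add] at e2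
      convert add_mem e1 e2 using 1
      rw [map_mul]
      ring
    · convert add_mem ha hb using 1
      rw [map_add]
      ring

theorem convSq_of_primitive {x : HCK K} (hx : comul K x = x ⊗ₜ[K] 1 + 1 ⊗ₜ[K] x) :
    convSq K x = 2 * x := by
  simp [convSq, hx, two_mul]

theorem counit_of_primitive {x : HCK K} (hx : comul K x = x ⊗ₜ[K] 1 + 1 ⊗ₜ[K] x) :
    counit K x = 0 := by
  have h : TensorProduct.lid K _ ((counit K).toLinearMap.rTensor _ (comul K x)) = x :=
    DFunLike.congr_fun (lid_counit_comp_comul (K := K)) x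
  rw [hx] at h
  have h' : algebraMap K (HCK K) (counit K x) = 0 := by
    simpa [Algebra.smul_def] using h
  simpa using h'

/-- On a primitive element `convSq` is multiplication by 2, but on I^k/I^(k+1) it is 2^k. For k ≥ 2
these differ in characteristic 0, so an element starting in I² lies in every power of I, and a
polynomial in all powers of I is zero. -/
theorem eq_zero_of_primitive_of_linPart_eq_zero [CharZero K] {x : HCK K}
    (hx : comul K x = x ⊗ₜ[K] 1 + 1 ⊗ₜ[K] x) (h : ∀ d : RTree → K, linPart d x = 0) :
    x = 0 := by
  have key : ∀ n, x ∈ MvPolynomial.idealOfVars RTree K ^ (n + 2) := by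
    intro n
    induction n with
    | zero => exact mem_sq_idealOfVars (counit_of_primitive hx) h
    | succ n ih =>
      have := convSq_sub_mem_pow ih
      rw [convSq_of_primitive hx, ← sub_mul] at this
      have hne : (2 - 2 ^ (n + 1 + 1) : K) ≠ 0 := by
        have h2 : (2 : K) ^ (n + 2) ≠ 2 := by
          have : (2 : ℕ) ^ (n + 2) ≠ 2 := by
            rw [pow_add]
            have := Nat.one_le_two_pow (n := n)
            omega
          exact_mod_cast this
        exact sub_ne_zero.2 h2.symm
      have e := Ideal.mul_mem_left _ (algebraMap K (HCK K) (2 - 2 ^ (n + 1 + 1))⁻¹) this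
      rw [← mul_assoc] at e
      have e1 : algebraMap K (HCK K) (2 - 2 ^ (n + 1 + 1))⁻¹ * (2 - 2 ^ (n + 1 + 1)) = 1 := by
        have : (2 - 2 ^ (n + 1 + 1) : HCK K) = algebraMap K (HCK K) (2 - 2 ^ (n + 1 + 1)) := by
          rw [map_sub, map_pow, map_ofNat]
        rw [this, ← map_mul, inv_mul_cancel₀ hne, map_one]
      rwa [e1, one_mul] at e
  ext m
  rw [(MvPolynomial.mem_pow_idealOfVars_iff' _ _).1 (key m.degree) m (by omega)]
  simp

/-! ## Contractions of the coproduct -/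

/-- `(id ⊗ f) ∘ Δ`. -/
noncomputable def contractRight (f : HCK K →ₗ[K] K) : HCK K →ₗ[K] HCK K :=
  (TensorProduct.rid K (HCK K)).toLinearMap ∘ₗ f.lTensor (HCK K) ∘ₗ (comul K).toLinearMap

/-- `(f ⊗ id) ∘ Δ`. -/
noncomputable def contractLeft (f : HCK K →ₗ[K] K) : HCK K →ₗ[K] HCK K :=
  (TensorProduct.lid K (HCK K)).toLinearMap ∘ₗ f.rTensor (HCK K) ∘ₗ (comul K).toLinearMap

theorem contractRight_apply (f : HCK K →ₗ[K] K) (x : HCK K) :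
    contractRight f x = TensorProduct.rid K _ (f.lTensor _ (comul K x)) := rfl

theorem contractLeft_apply (f : HCK K →ₗ[K] K) (x : HCK K) :
    contractLeft f x = TensorProduct.lid K _ (f.rTensor _ (comul K x)) := rfl

theorem contractRight_counit (x : HCK K) : contractRight (counit K).toLinearMap x = x :=
  DFunLike.congr_fun (rid_counit_comp_comul (K := K)) x

theorem contractLeft_counit (x : HCK K) : contractLeft (counit K).toLinearMap x = x :=
  DFunLike.congr_fun (lid_counit_comp_comul (K := K)) x

/-- Coassociativity with `f` applied to the third tensor factor. -/
theorem comul_contractRight (f : HCK K →ₗ[K] K) (x : HCK K) :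
    comul K (contractRight f x) = (contractRight f).lTensor (HCK K) (comul K x) := by
  have h := DFunLike.congr_fun (comul_coassoc (K := K)) x
  simp only [AlgHom.comp_apply] at h
  have h' := congrArg (fun z => ((TensorProduct.rid K (HCK K)).toLinearMap ∘ₗ
    f.lTensor (HCK K)).lTensor (HCK K) z) h
  convert h' using 1
  · rw [contractRight_apply]
    induction comul K x with
    | zero => simp
    | add a b ha hb => simp only [map_add, ha, hb]
    | tmul a b =>
      simp only [LinearMap.lTensor_tmul, TensorProduct.rid_tmul, map_smul,
        Algebra.TensorProduct.map_tmul, AlgHom.id_apply]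
      induction comul K a with
      | zero => simp
      | add a b ha hb => simp only [smul_add, TensorProduct.add_tmul, map_add, ha, hb]
      | tmul a c => simp
  · induction comul K x with
    | zero => simp
    | add a b ha hb => simp only [map_add, ha, hb]
    | tmul a b => simp [contractRight]

theorem comul_contractLeft (f : HCK K →ₗ[K] K) (x : HCK K) :
    comul K (contractLeft f x) = (contractLeft f).rTensor (HCK K) (comul K x) := by
  have h := DFunLike.congr_fun (comul_coassoc (K := K)) x
  simp only [AlgHom.comp_apply] at h
  have h' := congrArg (fun z => TensorProduct.lid K _ (f.rTensor (HCK K ⊗[K] HCK K) z)) h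
  convert h'.symm using 1
  · rw [contractLeft_apply]
    induction comul K x with
    | zero => simp
    | add a b ha hb => simp only [map_add, ha, hb]
    | tmul a b => simp
  · induction comul K x with
    | zero => simp
    | add a b ha hb => simp only [map_add, ha, hb]
    | tmul a b =>
      simp only [LinearMap.rTensor_tmul, Algebra.TensorProduct.map_tmul, AlgHom.id_apply,
        contractLeft_apply]
      induction comul K a with
      | zero => simp
      | add a b ha hb => simp only [TensorProduct.add_tmul, map_add, ha, hb]
      | tmul a c => simp [TensorProduct.smul_tmul']

/-- Multiplicativity of Δ and the derivation rule for `linPart d` combine: in each term one factor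
is contracted with `linPart d`, and the other with the counit, which returns it unchanged. -/
theorem contractRight_linPart_mul (d : RTree → K) (x y : HCK K) :
    contractRight (linPart d) (x * y) =
      contractRight (linPart d) x * y + x * contractRight (linPart d) y := by
  have key : ∀ z w : HCK K ⊗[K] HCK K,
      TensorProduct.rid K _ ((linPart d).lTensor _ (z * w)) =
      TensorProduct.rid K _ ((linPart d).lTensor _ z) *
        TensorProduct.rid K _ ((counit K).toLinearMap.lTensor _ w) +
      TensorProduct.rid K _ ((counit K).toLinearMap.lTensor _ z) *
        TensorProduct.rid K _ ((linPart d).lTensor _ w) := by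
    intro z w
    induction z with
    | zero => simp
    | add a b ha hb => simp only [add_mul, map_add, ha, hb]; ring
    | tmul a b =>
      induction w with
      | zero => simp
      | add a b ha hb => simp only [mul_add, map_add, ha, hb]; ring
      | tmul a' b' =>
        simp [linPart_mul, add_smul, mul_smul, add_comm, smul_comm (counit K _)]
  rw [contractRight_apply, map_mul, key]
  simp only [← contractRight_apply, contractRight_counit]

theorem contractLeft_linPart_mul (d : RTree → K) (x y : HCK K) :
    contractLeft (linPart d) (x * y) =
      contractLeft (linPart d) x * y + x * contractLeft (linPart d) y := by
  have key : ∀ z w : HCK K ⊗[K] HCK K,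
      TensorProduct.lid K _ ((linPart d).rTensor _ (z * w)) =
      TensorProduct.lid K _ ((linPart d).rTensor _ z) *
        TensorProduct.lid K _ ((counit K).toLinearMap.rTensor _ w) +
      TensorProduct.lid K _ ((counit K).toLinearMap.rTensor _ z) *
        TensorProduct.lid K _ ((linPart d).rTensor _ w) := by
    intro z w
    induction z with
    | zero => simp
    | add a b ha hb => simp only [add_mul, map_add, ha, hb]; ring
    | tmul a b =>
      induction w with
      | zero => simp
      | add a b ha hb => simp only [mul_add, map_add, ha, hb]; ring
      | tmul a' b' =>
        simp [linPart_mul, add_smul, mul_smul, add_comm, smul_comm (counit K _)]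
  rw [contractLeft_apply, map_mul, key]
  simp only [← contractLeft_apply, contractLeft_counit]

theorem counit_contractRight (f : HCK K →ₗ[K] K) (x : HCK K) :
    counit K (contractRight f x) = f x := by
  conv_rhs => rw [← contractLeft_counit x]
  rw [contractRight_apply, contractLeft_apply]
  induction comul K x with
  | zero => simp
  | add a b ha hb => simp only [map_add, ha, hb]
  | tmul a b => simp [mul_comm]

/-- The bracket of two infinitesimal characters is an infinitesimal character. -/
noncomputable def bracket (d d' : RTree → K) : HCK K →ₗ[K] K :=
  linPart d ∘ₗ contractRight (linPart d') - linPart d' ∘ₗ contractRight (linPart d)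

theorem bracket_apply (d d' : RTree → K) (x : HCK K) :
    bracket d d' x = linPart d (contractRight (linPart d') x) -
      linPart d' (contractRight (linPart d) x) := rfl

/-- Each composite alone fails to be a derivation on products, but its mixed terms are symmetric in
`d` and `d'` and cancel in the commutator. -/
theorem bracket_eq_linPart (d d' : RTree → K) :
    bracket d d' = linPart fun t => bracket d d' (MvPolynomial.X t : HCK K) := by
  refine eq_linPart_of_map_mul fun x y => ?_
  simp only [bracket_apply, contractRight_linPart_mul, map_add, linPart_mul,
    counit_contractRight, smul_eq_mul]
  ring

/-! ## The antipode -/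

theorem antipode_comp_comul :
    ((Algebra.TensorProduct.lmul' K).comp
      (Algebra.TensorProduct.map (antipode K) (AlgHom.id K (HCK K)))).comp (comul K) =
        (Algebra.ofId K (HCK K)).comp (counit K) := by
  ext1 t
  have hS : ∀ F, antipode K (forest K F) = (F.map (antipodeTree K)).prod := by
    intro F
    rw [forest, map_multiset_prod, Multiset.map_map]
    simp [antipode]
  rw [AlgHom.comp_apply, AlgHom.comp_apply, AlgHom.comp_apply, counit_X, map_zero, comul_X,
    map_add, map_add, map_multiset_sum, map_multiset_sum, Multiset.map_map, Multiset.map_map]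
  have h : antipode K (MvPolynomial.X t) = antipodeTree K t := by simp [antipode]
  simp [h, antipodeTree_eq K t, Function.comp_def, hS]

/-! ## Feynman rules and infinitesimal characters -/

theorem polyCounit_apply (f : Polynomial K) : polyCounit K f = f.coeff 0 := by
  rw [polyCounit, Polynomial.coe_aeval_eq_eval, Polynomial.coeff_zero_eq_eval_zero]

theorem lid_coeff_zero_polyComul (f : Polynomial K) :
    TensorProduct.lid K _ ((Polynomial.lcoeff K 0).rTensor _ (polyComul K f)) = f := by
  have key : ∀ z : Polynomial K ⊗[K] Polynomial K,
      TensorProduct.lid K _ ((Polynomial.lcoeff K 0).rTensor _ z) =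
        Algebra.TensorProduct.lid K _ (Algebra.TensorProduct.map (polyCounit K)
          (AlgHom.id K (Polynomial K)) z) := by
    intro z
    induction z with
    | zero => simp
    | add a b ha hb => simp only [map_add, ha, hb]
    | tmul a b => simp [polyCounit_apply]
  rw [key]
  have : ((Algebra.TensorProduct.lid K (Polynomial K)).toAlgHom.comp
      (Algebra.TensorProduct.map (polyCounit K) (AlgHom.id K (Polynomial K)))).comp
        (polyComul K) = AlgHom.id K _ := by
    ext1
    simp [polyComul, polyCounit]
  exact DFunLike.congr_fun this f

/-- Taylor's formula: the term of first order in the left variable of f(L ⊗ 1 + 1 ⊗ L) is the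
derivative of f. -/
theorem lid_coeff_one_polyComul (f : Polynomial K) :
    TensorProduct.lid K _ ((Polynomial.lcoeff K 1).rTensor _ (polyComul K f)) =
      Polynomial.derivative f := by
  have key : ∀ z w : Polynomial K ⊗[K] Polynomial K,
      TensorProduct.lid K _ ((Polynomial.lcoeff K 1).rTensor _ (z * w)) =
      TensorProduct.lid K _ ((Polynomial.lcoeff K 1).rTensor _ z) *
        TensorProduct.lid K _ ((Polynomial.lcoeff K 0).rTensor _ w) +
      TensorProduct.lid K _ ((Polynomial.lcoeff K 0).rTensor _ z) *
        TensorProduct.lid K _ ((Polynomial.lcoeff K 1).rTensor _ w) := by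
    intro z w
    induction z with
    | zero => simp
    | add a b ha hb => simp only [add_mul, map_add, ha, hb]; ring
    | tmul a b =>
      induction w with
      | zero => simp
      | add a b ha hb => simp only [mul_add, map_add, ha, hb]; ring
      | tmul a' b' =>
        simp [Polynomial.mul_coeff_one, add_smul, mul_smul, add_comm,
          smul_comm (Polynomial.coeff a _)]
  induction f using Polynomial.induction_on with
  | C a => simp [polyComul, Algebra.TensorProduct.algebraMap_apply]
  | add p q hp hq => simp only [map_add, hp, hq]
  | monomial n a ih =>
    rw [pow_succ, ← mul_assoc, map_mul, key, ih, lid_coeff_zero_polyComul,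
      lid_coeff_zero_polyComul,
      Polynomial.derivative_mul (f := _ * Polynomial.X ^ n), Polynomial.derivative_X]
    simp [polyComul, Polynomial.coeff_one]

section

variable {φ : HCK K →ₐ[K] Polynomial K}

theorem IsFeynmanRules.coeff_zero (hφ : IsFeynmanRules φ) (x : HCK K) :
    (φ x).coeff 0 = CK.counit K x := by
  rw [← hφ.counit]
  simp [polyCounit_apply]

theorem IsFeynmanRules.coeff_one (hφ : IsFeynmanRules φ) (x : HCK K) :
    (φ x).coeff 1 = linPart (fun t => (φ (MvPolynomial.X t)).coeff 1) x := by
  have h := eq_linPart_of_map_mul (f := Polynomial.lcoeff K 1 ∘ₗ φ.toLinearMap) (fun x y => by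
    simp [Polynomial.mul_coeff_one, hφ.coeff_zero]
    ring)
  exact LinearMap.congr_fun h x

/-- Obtained by extracting the coefficient of L in the left factor of (φ ⊗ φ) Δ = Δ φ. It turns the
differential equation for the Green function into a statement on coproducts. -/
theorem IsFeynmanRules.derivative (hφ : IsFeynmanRules φ) (x : HCK K) :
    Polynomial.derivative (φ x) =
      φ (contractLeft (linPart fun t => (φ (MvPolynomial.X t)).coeff 1) x) := by
  have h : Algebra.TensorProduct.map φ φ (CK.comul K x) = polyComul K (φ x) :=
    DFunLike.congr_fun hφ.comul x
  rw [← lid_coeff_one_polyComul, ← h, contractLeft_apply]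
  induction CK.comul K x with
  | zero => simp
  | add a b ha hb => simp only [map_add, ha, hb]
  | tmul a b => simp [hφ.coeff_one a]

end

/-- The primitive of a polynomial without constant term. -/
noncomputable def polyIntegral (K : Type*) [Field K] : Polynomial K →ₗ[K] Polynomial K :=
  Polynomial.lsum fun n => ((n : K) + 1)⁻¹ • Polynomial.monomial (n + 1)

theorem polyIntegral_monomial (n : ℕ) (a : K) :
    polyIntegral K (Polynomial.monomial n a) =
      Polynomial.monomial (n + 1) (((n : K) + 1)⁻¹ * a) := by
  simp [polyIntegral, Polynomial.lsum_apply, Polynomial.smul_monomial]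

theorem coeff_zero_polyIntegral (f : Polynomial K) : (polyIntegral K f).coeff 0 = 0 := by
  induction f using Polynomial.induction_on' with
  | add p q hp hq => simp [hp, hq]
  | monomial n a => rw [polyIntegral_monomial, Polynomial.coeff_monomial, if_neg (by omega)]

theorem derivative_polyIntegral [CharZero K] (f : Polynomial K) :
    Polynomial.derivative (polyIntegral K f) = f := by
  induction f using Polynomial.induction_on' with
  | add p q hp hq => simp [hp, hq]
  | monomial n a =>
    rw [polyIntegral_monomial, Polynomial.derivative_monomial]
    have : (n : K) + 1 ≠ 0 := by exact_mod_cast n.succ_ne_zero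
    congr 1
    push_cast
    field_simp

theorem polyIntegral_derivative [CharZero K] (f : Polynomial K) :
    polyIntegral K (Polynomial.derivative f) = f - Polynomial.C (f.coeff 0) := by
  induction f using Polynomial.induction_on' with
  | add p q hp hq => simp [hp, hq]; ring
  | monomial n a =>
    rw [Polynomial.derivative_monomial, polyIntegral_monomial]
    cases n with
    | zero => simp
    | succ n =>
      have : (n : K) + 1 ≠ 0 := by exact_mod_cast n.succ_ne_zero
      simp only [Polynomial.coeff_monomial, Nat.add_sub_cancel]
      rw [if_neg (by omega), map_zero, sub_zero]
      congr 1
      push_cast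
      field_simp

/-- The value on trees of the Feynman rules with infinitesimal generator `d`. -/
noncomputable def feynmanTree (d : RTree → K) (t : RTree) : Polynomial K :=
  polyIntegral K (Polynomial.C (d t) + (t.cuts.map fun q =>
    if _h : q.2.size < t.size then linPart d (forest K q.1) • feynmanTree d q.2 else 0).sum)
termination_by t.size

/-- The Feynman rules with infinitesimal generator `d`. -/
noncomputable def feynman (d : RTree → K) : HCK K →ₐ[K] Polynomial K :=
  MvPolynomial.aeval (feynmanTree d)

/-- This makes the size test in `feynmanTree` harmless: a cut failing it prunes nothing, and the
linear part of the empty forest is zero. -/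
theorem eq_zero_of_mem_cuts {t : RTree} {q : Multiset RTree × RTree} (hq : q ∈ t.cuts)
    (h : ¬ q.2.size < t.size) : q.1 = 0 := by
  have h1 := t.size_add_of_mem_cuts q hq
  exact eq_zero_of_sum_size_eq_zero (by omega)

theorem contractLeft_linPart_X (d : RTree → K) (t : RTree) :
    contractLeft (linPart d) (MvPolynomial.X t) = d t • 1 +
      (t.cuts.map fun q => if q.2.size < t.size then
        linPart d (forest K q.1) • (MvPolynomial.X q.2 : HCK K) else 0).sum := by
  rw [contractLeft_apply, comul_X, map_add, map_add, map_multiset_sum, map_multiset_sum,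
    Multiset.map_map, Multiset.map_map]
  congr 1
  · simp
  · refine congrArg Multiset.sum (Multiset.map_congr rfl fun q hq => ?_)
    split_ifs with h
    · simp
    · simp [eq_zero_of_mem_cuts hq h]

theorem derivative_feynman [CharZero K] (d : RTree → K) (x : HCK K) :
    Polynomial.derivative (feynman d x) = feynman d (contractLeft (linPart d) x) := by
  have hX : ∀ t, Polynomial.derivative (feynman d (MvPolynomial.X t)) =
      feynman d (contractLeft (linPart d) (MvPolynomial.X t)) := by
    intro t
    rw [contractLeft_linPart_X, map_add, map_multiset_sum, Multiset.map_map, feynman,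
      MvPolynomial.aeval_X, feynmanTree, derivative_polyIntegral]
    congr 1
    · rw [map_smul, map_one, Polynomial.smul_eq_C_mul, mul_one]
    · refine congrArg Multiset.sum (Multiset.map_congr rfl fun q hq => ?_)
      simp only [Function.comp_apply]
      split_ifs with h
      · rw [map_smul, MvPolynomial.aeval_X]
      · rw [map_zero]
  induction x using MvPolynomial.induction_on with
  | C a =>
    have h : (MvPolynomial.C a : HCK K) = a • 1 := by
      rw [← MvPolynomial.algebraMap_eq, Algebra.algebraMap_eq_smul_one]
    rw [h, map_smul, map_smul, map_one (feynman d), map_smul, contractLeft_apply,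
      map_one (comul K)]
    simp [Algebra.TensorProduct.one_def]
  | add p q hp hq => simp only [map_add, hp, hq]
  | mul_X p t hp =>
    rw [map_mul, Polynomial.derivative_mul, hp, hX, contractLeft_linPart_mul, map_add, map_mul,
      map_mul]

theorem coeff_zero_feynman (d : RTree → K) (x : HCK K) :
    (feynman d x).coeff 0 = counit K x := by
  have h : (polyCounit K).comp (feynman d) = counit K := by
    ext1 t
    have : (feynmanTree d t).coeff 0 = 0 := by rw [feynmanTree, coeff_zero_polyIntegral]
    simp [polyCounit_apply, feynman, this]
  rw [← h]
  simp [polyCounit_apply]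

/-- Differentiation commutes with translation of the variable. -/
theorem rTensor_derivative_polyComul (f : Polynomial K) :
    (Polynomial.derivative (R := K)).rTensor (Polynomial K) (polyComul K f) =
      polyComul K (Polynomial.derivative f) := by
  have key : ∀ z w : Polynomial K ⊗[K] Polynomial K,
      (Polynomial.derivative (R := K)).rTensor (Polynomial K) (z * w) =
        (Polynomial.derivative (R := K)).rTensor (Polynomial K) z * w +
          z * (Polynomial.derivative (R := K)).rTensor (Polynomial K) w := by
    intro z w
    induction z with
    | zero => simp
    | add a b ha hb => simp only [add_mul, map_add, ha, hb]; ring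
    | tmul a b =>
      induction w with
      | zero => simp
      | add a b ha hb => simp only [mul_add, map_add, ha, hb]; ring
      | tmul a' b' => simp [Polynomial.derivative_mul, TensorProduct.add_tmul]
  induction f using Polynomial.induction_on with
  | C a => simp [polyComul, Algebra.TensorProduct.algebraMap_apply]
  | add p q hp hq => simp only [map_add, hp, hq]
  | monomial n a ih =>
    rw [pow_succ, ← mul_assoc, map_mul, key, ih,
      Polynomial.derivative_mul (f := _ * Polynomial.X ^ n),
      Polynomial.derivative_X, map_add, map_mul (polyComul K) _ Polynomial.X,
      map_mul (polyComul K) _ 1, map_one (polyComul K)]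
    congr 2
    simp [polyComul, Algebra.TensorProduct.one_def]

theorem eq_zero_of_rTensor_derivative [CharZero K] {z : Polynomial K ⊗[K] Polynomial K}
    (h0 : (Polynomial.lcoeff K 0).rTensor (Polynomial K) z = 0)
    (h1 : (Polynomial.derivative (R := K)).rTensor (Polynomial K) z = 0) : z = 0 := by
  -- A tensor is recovered from its left derivative by integration, up to its value at 0 on the
  -- left.
  have key : ∀ z : Polynomial K ⊗[K] Polynomial K, z =
      (polyIntegral K).rTensor _ ((Polynomial.derivative (R := K)).rTensor (Polynomial K) z) +
        (Algebra.linearMap K (Polynomial K)).rTensor _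
          ((Polynomial.lcoeff K 0).rTensor (Polynomial K) z) := by
    intro z
    induction z with
    | zero => simp
    | add a b ha hb =>
      nth_rewrite 1 [ha, hb]
      simp only [map_add]
      abel
    | tmul a b => simp [polyIntegral_derivative, TensorProduct.sub_tmul]
  rw [key z, h0, h1, map_zero, map_zero, add_zero]

/-- The defect (φ ⊗ φ) Δ - Δ φ vanishes at 0 in the left variable, and its left derivative on a tree
is a combination of its values on smaller trees. It is therefore zero by induction on size. -/
theorem isFeynmanRules_feynman [CharZero K] (d : RTree → K) : IsFeynmanRules (feynman d) where
  counit := by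
    ext1 t
    rw [← coeff_zero_feynman d]
    simp [polyCounit_apply]
  comul := by
    set φ := feynman d
    set R : HCK K →ₗ[K] Polynomial K ⊗[K] Polynomial K :=
      ((Algebra.TensorProduct.map φ φ).comp (CK.comul K)).toLinearMap -
        ((polyComul K).comp φ).toLinearMap with hR
    have hRx : ∀ x, R x = Algebra.TensorProduct.map φ φ (CK.comul K x) - polyComul K (φ x) :=
      fun x => rfl
    have hR1 : R 1 = 0 := by simp [hRx]
    have h0 : ∀ x, (Polynomial.lcoeff K 0).rTensor (Polynomial K) (R x) = 0 := by
      intro x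
      apply (TensorProduct.lid K (Polynomial K)).injective
      rw [hRx, map_sub, map_sub, lid_coeff_zero_polyComul, map_zero, sub_eq_zero]
      conv_rhs => rw [← contractLeft_counit x, contractLeft_apply]
      induction CK.comul K x with
      | zero => simp
      | add a b ha hb => simp only [map_add, ha, hb]
      | tmul a b => simp [φ, coeff_zero_feynman]
    have h1 : ∀ x, (Polynomial.derivative (R := K)).rTensor (Polynomial K) (R x) =
        R (contractLeft (linPart d) x) := by
      intro x
      rw [hRx, hRx, map_sub, rTensor_derivative_polyComul, derivative_feynman,
        comul_contractLeft]
      congr 1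
      induction CK.comul K x with
      | zero => simp
      | add a b ha hb => simp only [map_add, ha, hb]
      | tmul a b => simp [φ, derivative_feynman]
    have hX : ∀ n, ∀ t : RTree, t.size = n → R (MvPolynomial.X t) = 0 := by
      intro n
      induction n using Nat.strong_induction_on with
      | _ n ih =>
        intro t ht
        refine eq_zero_of_rTensor_derivative (h0 _) ?_
        rw [h1, contractLeft_linPart_X, map_add, map_smul, hR1, smul_zero, zero_add,
          map_multiset_sum, Multiset.map_map]
        refine Multiset.sum_eq_zero fun y hy => ?_
        obtain ⟨q, hq, rfl⟩ := Multiset.mem_map.1 hy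
        simp only [Function.comp_apply]
        split_ifs with h
        · rw [map_smul, ih _ (ht ▸ h) _ rfl, smul_zero]
        · exact map_zero R
    ext1 t
    exact sub_eq_zero.1 (hX _ t rfl)

/-! ## Exponentials of power series -/

/-- `W` is the exponential of `Y`, up to the constant term of `Y`. -/
structure IsExp {R : Type*} [CommRing R] (Y W : PowerSeries R) : Prop where
  constantCoeff : PowerSeries.constantCoeff W = 1
  derivative : PowerSeries.derivative R W = PowerSeries.derivative R Y * W

section IsExp

open PowerSeries in
theorem derivative_map {R S : Type*} [CommRing R] [CommRing S] (f : R →+* S)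
    (Y : PowerSeries R) : d⁄dX S (PowerSeries.map f Y) = PowerSeries.map f (d⁄dX R Y) := by
  refine PowerSeries.ext fun n => ?_
  rw [PowerSeries.coeff_derivative, PowerSeries.coeff_map, PowerSeries.coeff_map,
    PowerSeries.coeff_derivative]
  simp

variable {R : Type*} [CommRing R]

theorem IsExp.map {S : Type*} [CommRing S] (f : R →+* S) {Y W : PowerSeries R} (h : IsExp Y W) :
    IsExp (PowerSeries.map f Y) (PowerSeries.map f W) where
  constantCoeff := by
    rw [← PowerSeries.coeff_zero_eq_constantCoeff_apply, PowerSeries.coeff_map,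
      PowerSeries.coeff_zero_eq_constantCoeff_apply, h.constantCoeff, map_one]
  derivative := by rw [derivative_map, derivative_map, h.derivative, map_mul]

theorem IsExp.mul {Y W Y' W' : PowerSeries R} (h : IsExp Y W) (h' : IsExp Y' W') :
    IsExp (Y + Y') (W * W') where
  constantCoeff := by simp [h.constantCoeff, h'.constantCoeff]
  derivative := by
    rw [Derivation.leibniz, h.derivative, h'.derivative, map_add, smul_eq_mul, smul_eq_mul]
    ring

theorem IsExp.coeff_succ {Y W : PowerSeries R} (h : IsExp Y W) (n : ℕ) :
    ((n : R) + 1) * PowerSeries.coeff (n + 1) W = ∑ p ∈ antidiagonal n,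
      ((p.1 : R) + 1) * PowerSeries.coeff (p.1 + 1) Y * PowerSeries.coeff p.2 W := by
  have := congrArg (PowerSeries.coeff n) h.derivative
  rw [PowerSeries.coeff_mul, PowerSeries.coeff_derivative, mul_comm] at this
  rw [this]
  refine Finset.sum_congr rfl fun p _ => ?_
  rw [PowerSeries.coeff_derivative, mul_comm (_ + 1 : R)]

section Algebra

variable (K) [CharZero K] [Algebra K R]

include K in
theorem natCast_succ_mul_cancel {n : ℕ} {a b : R} (h : ((n : R) + 1) * a = ((n : R) + 1) * b) :
    a = b := by
  have hK : (n : K) + 1 ≠ 0 := by exact_mod_cast n.succ_ne_zero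
  have e : algebraMap K R ((n : K) + 1)⁻¹ * ((n : R) + 1) = 1 := by
    rw [show (n : R) + 1 = algebraMap K R ((n : K) + 1) by simp, ← map_mul, inv_mul_cancel₀ hK,
      map_one]
  rw [← one_mul a, ← one_mul b, ← e, mul_assoc, mul_assoc, h]

include K in
-- The recursion `IsExp.coeff_succ` determines each coefficient of the exponential from lower ones;
-- only the coefficients of the exponents up to degree `N` enter.
theorem IsExp.unique {Y Y' W W' : PowerSeries R} (h : IsExp Y W) (h' : IsExp Y' W') (N : ℕ)
    (hY : ∀ n ≤ N, n ≠ 0 → PowerSeries.coeff n Y = PowerSeries.coeff n Y') :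
    ∀ n ≤ N, PowerSeries.coeff n W = PowerSeries.coeff n W' := by
  intro n
  induction n using Nat.strong_induction_on with
  | _ n ih =>
    intro hn
    cases n with
    | zero => simp [h.constantCoeff, h'.constantCoeff]
    | succ n =>
      refine natCast_succ_mul_cancel K (n := n) ?_
      rw [h.coeff_succ, h'.coeff_succ]
      refine Finset.sum_congr rfl fun p hp => ?_
      have := mem_antidiagonal.1 hp
      rw [hY _ (by omega) (by omega), ih _ (by omega) (by omega)]

include K in
-- An exponential is a unit, so its logarithmic derivative fixes the exponent up to its constant
-- term.
theorem IsExp.coeff_eq_of_exp_eq {Y Y' W : PowerSeries R} (h : IsExp Y W) (h' : IsExp Y' W)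
    {n : ℕ} (hn : n ≠ 0) : PowerSeries.coeff n Y = PowerSeries.coeff n Y' := by
  have hW : IsUnit W := PowerSeries.isUnit_iff_constantCoeff.2 (by simp [h.constantCoeff])
  have e := hW.mul_right_cancel (h.derivative.symm.trans h'.derivative)
  obtain ⟨n, rfl⟩ := Nat.exists_eq_succ_of_ne_zero hn
  have := congrArg (PowerSeries.coeff n) e
  rw [PowerSeries.coeff_derivative, PowerSeries.coeff_derivative, mul_comm,
    mul_comm _ (_ + 1 : R)] at this
  exact natCast_succ_mul_cancel K this

open PowerSeries in
omit [CharZero K] in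
theorem derivative_subst_algebra (f : PowerSeries K) {Y : PowerSeries R}
    (hY : PowerSeries.HasSubst Y) :
    d⁄dX R (f.subst Y) = (d⁄dX K f).subst Y * d⁄dX R Y := by
  have h : ∀ g : PowerSeries K, g.subst Y = (PowerSeries.map (algebraMap K R) g).subst Y := by
    intro g
    ext n
    rw [PowerSeries.coeff_subst' hY, PowerSeries.coeff_subst' hY]
    simp [Algebra.smul_def]
  rw [h, PowerSeries.derivative_subst hY, derivative_map, ← h]

theorem isExp_exp_subst {Y : PowerSeries R} (hY : PowerSeries.constantCoeff Y = 0) :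
    IsExp Y ((PowerSeries.exp K).subst Y) where
  constantCoeff := by
    have hs := PowerSeries.HasSubst.of_constantCoeff_zero' hY
    have h := PowerSeries.constantCoeff_subst_eq_zero hY (PowerSeries.exp K - 1) (by simp)
    rw [PowerSeries.subst_sub hs, map_sub, sub_eq_zero] at h
    refine h.trans ?_
    rw [← PowerSeries.coe_substAlgHom hs, map_one, map_one]
  derivative := by
    rw [derivative_subst_algebra K _ (PowerSeries.HasSubst.of_constantCoeff_zero' hY),
      PowerSeries.derivative_exp, mul_comm]

theorem isExp_log_subst {W : PowerSeries R} (hW : PowerSeries.constantCoeff W = 1) :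
    IsExp ((PowerSeries.log K).subst (W - 1)) W where
  constantCoeff := hW
  derivative := by
    have hs : PowerSeries.HasSubst (W - 1) :=
      PowerSeries.HasSubst.of_constantCoeff_zero' (by simp [hW])
    -- Substituting W - 1 for X turns this into W · log'(W - 1) = 1.
    have h1 : (1 + PowerSeries.X) * PowerSeries.derivative K (PowerSeries.log K) = 1 := by
      rw [PowerSeries.deriv_log]
      ext n
      cases n with
      | zero => simp
      | succ n => simp [add_mul, PowerSeries.coeff_succ_X_mul, PowerSeries.coeff_one, pow_succ]
    have h2 := congrArg (PowerSeries.substAlgHom hs) h1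
    rw [map_mul, map_add, map_one, PowerSeries.substAlgHom_X, PowerSeries.coe_substAlgHom,
      add_sub_cancel] at h2
    rw [derivative_subst_algebra K _ hs, map_sub, Derivation.map_one_eq_zero, sub_zero,
      mul_right_comm, mul_comm _ W, h2, one_mul]

end Algebra

/-! ## The logarithm of the series of ladders -/

/-- Since h has no constant term, only index tuples with positive entries contribute to h^r, and
these are compositions of length r. The combinatorial definition of `ladderLog` thereby becomes a
logarithm. -/
theorem coeff_pow_eq_sum_composition (h : PowerSeries R)
    (h0 : PowerSeries.constantCoeff h = 0) (r n : ℕ) :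
    PowerSeries.coeff n (h ^ r) = ∑ c : Composition n with c.length = r,
      (c.blocks.map fun j => PowerSeries.coeff j h).prod := by
  classical
  have e : h ^ r = ∏ _i : Fin r, h := by simp
  rw [e, PowerSeries.coeff_prod, ← Finset.sum_filter_of_ne (p := fun l => ∀ i, l i ≠ 0)]
  · refine Finset.sum_bij (fun l hl => ⟨List.ofFn l, ?_, ?_⟩) ?_ ?_ ?_ ?_
    · intro i hi
      obtain ⟨j, rfl⟩ := (List.mem_ofFn' _ _).1 hi
      exact Nat.pos_of_ne_zero ((Finset.mem_filter.1 hl).2 j)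
    · rw [List.sum_ofFn]
      exact (Finset.mem_finsuppAntidiag.1 (Finset.mem_filter.1 hl).1).1
    · intro l hl
      simp [Composition.length]
    · intro l hl l' hl' hll
      exact DFunLike.coe_injective (List.ofFn_injective (congrArg Composition.blocks hll))
    · intro c hc
      obtain rfl : c.length = r := (Finset.mem_filter.1 hc).2
      refine ⟨Finsupp.equivFunOnFinite.symm c.blocksFun, ?_, ?_⟩
      · refine Finset.mem_filter.2 ⟨Finset.mem_finsuppAntidiag.2 ⟨?_, Finset.subset_univ _⟩, ?_⟩
        · simp
        · intro i
          exact (c.blocks_pos' i i.2).ne'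
      · ext1
        simp
    · intro l hl
      simp [List.map_ofFn, List.prod_ofFn]
  · intro l _ hl i hi
    exact hl (Finset.prod_eq_zero (Finset.mem_univ i) (by simp [hi, h0]))

end IsExp

variable (K) in
/-- The power series `1 + ∑ ℓ_k x^k`. -/
noncomputable def ladderSeries : PowerSeries (HCK K) := PowerSeries.mk (ladder K)

variable (K) in
/-- The power series `∑ p_k x^k`. -/
noncomputable def ladderLogSeries : PowerSeries (HCK K) := PowerSeries.mk (ladderLog K)

theorem constantCoeff_ladderSeries : PowerSeries.constantCoeff (ladderSeries K) = 1 := by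
  rw [← PowerSeries.coeff_zero_eq_constantCoeff_apply, ladderSeries, PowerSeries.coeff_mk, ladder]

theorem ladderLogSeries_eq [CharZero K] :
    ladderLogSeries K = (PowerSeries.log K).subst (ladderSeries K - 1) := by
  have h0 : PowerSeries.constantCoeff (ladderSeries K - 1) = 0 := by
    simp [constantCoeff_ladderSeries]
  have hs := PowerSeries.HasSubst.of_constantCoeff_zero' h0
  ext1 n
  rw [PowerSeries.coeff_subst' hs, finsum_eq_sum_of_support_subset (s := Finset.range (n + 1))]
  · rw [ladderLogSeries, PowerSeries.coeff_mk, ladderLog,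
      ← Finset.sum_fiberwise_of_maps_to (s := Finset.univ) (t := Finset.range (n + 1))
        (g := Composition.length) (fun c _ => Finset.mem_range.2 (by have := c.length_le; omega))]
    refine Finset.sum_congr rfl fun r _ => ?_
    rw [coeff_pow_eq_sum_composition _ h0, Finset.smul_sum]
    refine Finset.sum_congr rfl fun c hc => ?_
    obtain rfl := (Finset.mem_filter.1 hc).2
    have hb : c.blocks.map (fun j => PowerSeries.coeff j (ladderSeries K - 1)) =
        c.blocks.map (ladder K) := by
      refine List.map_congr_left fun j hj => ?_
      have := c.blocks_pos hj
      simp [ladderSeries, PowerSeries.coeff_one, this.ne']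
    rw [hb, PowerSeries.coeff_log]
    split_ifs with h
    · simp [h]
    · simp
  · intro r hr
    by_contra h
    refine hr ?_
    simp only [Finset.coe_range, Set.mem_Iio, not_lt] at h
    simp only
    rw [PowerSeries.coeff_of_lt_order (φ := _ ^ r), smul_zero]
    have := PowerSeries.le_order_pow_of_constantCoeff_eq_zero r h0
    exact lt_of_lt_of_le (by exact_mod_cast h) this

theorem isExp_ladder [CharZero K] : IsExp (ladderLogSeries K) (ladderSeries K) := by
  rw [ladderLogSeries_eq]
  exact isExp_log_subst K constantCoeff_ladderSeries

/-! ## Group-like sequences -/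

/-- The formal sum of the sequence is group-like. -/
structure IsGroupLikeSeq (x : ℕ → HCK K) : Prop where
  zero : x 0 = 1
  comul : ∀ n, comul K (x n) = ∑ p ∈ antidiagonal n, x p.1 ⊗ₜ[K] x p.2

variable (K) in
/-- The inclusion as left factor of the tensor square. -/
noncomputable abbrev inclL : HCK K →+* HCK K ⊗[K] HCK K :=
  (Algebra.TensorProduct.includeLeft (R := K) (S := K) (A := HCK K) (B := HCK K)).toRingHom

variable (K) in
/-- The inclusion as right factor of the tensor square. -/
noncomputable abbrev inclR : HCK K →+* HCK K ⊗[K] HCK K :=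
  (Algebra.TensorProduct.includeRight (R := K) (A := HCK K) (B := HCK K)).toRingHom

/-- Group-likeness is expressed as an identity of power series over H ⊗ H, so that exponentials can
be compared there. -/
theorem comul_coeff_iff (W : PowerSeries (HCK K)) :
    (∀ n, comul K (PowerSeries.coeff n W) = ∑ p ∈ antidiagonal n,
        PowerSeries.coeff p.1 W ⊗ₜ[K] PowerSeries.coeff p.2 W) ↔
      PowerSeries.map (comul K).toRingHom W =
        PowerSeries.map (inclL K) W * PowerSeries.map (inclR K) W := by
  rw [PowerSeries.ext_iff]
  refine forall_congr' fun n => ?_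
  rw [PowerSeries.coeff_mul]
  simp

theorem ladder_isGroupLikeSeq : IsGroupLikeSeq (ladder K) where
  zero := rfl
  comul n := by
    induction n with
    | zero => simp [ladder, Algebra.TensorProduct.one_def]
    | succ n ih =>
      rw [ladder, comul_addRoot, ih, map_sum, Finset.Nat.antidiagonal_succ', Finset.sum_cons,
        Finset.sum_map]
      rfl

/-- The ladder series W is group-like, so Δ(W) = (W ⊗ 1)(1 ⊗ W). Both sides are exponentials, and
comparing exponents gives primitivity of the logarithm. -/
theorem ladderLog_primitive [CharZero K] {n : ℕ} (hn : n ≠ 0) :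
    comul K (ladderLog K n) = ladderLog K n ⊗ₜ[K] 1 + 1 ⊗ₜ[K] ladderLog K n := by
  have h1 := (isExp_ladder (K := K)).map (comul K).toRingHom
  have h2 := ((isExp_ladder (K := K)).map (inclL K)).mul ((isExp_ladder (K := K)).map (inclR K))
  rw [← (comul_coeff_iff (ladderSeries K)).1
    (by simpa [ladderSeries] using ladder_isGroupLikeSeq.comul)] at h2
  simpa [ladderLogSeries] using h1.coeff_eq_of_exp_eq K h2 hn

theorem IsExp.isGroupLikeSeq [CharZero K] {Y W : PowerSeries (HCK K)} (h : IsExp Y W)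
    (hY : ∀ n ≠ 0, comul K (PowerSeries.coeff n Y) =
      PowerSeries.coeff n Y ⊗ₜ[K] 1 + 1 ⊗ₜ[K] PowerSeries.coeff n Y) :
    IsGroupLikeSeq fun n => PowerSeries.coeff n W where
  zero := by simp [h.constantCoeff]
  comul := by
    rw [comul_coeff_iff]
    ext1 n
    exact (h.map (comul K).toRingHom).unique K ((h.map (inclL K)).mul (h.map (inclR K))) n
      (fun m _ hm => by simp [hY m hm]) n le_rfl

/-- In W' = Y' W every term other than the one with the constant term of W is a product of two
elements killed by the counit, hence has no linear part. -/
theorem IsExp.linPart_coeff [CharZero K] {M : Type*} [AddCommGroup M] [Module K M]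
    (d : RTree → M) {Y W : PowerSeries (HCK K)} (h : IsExp Y W)
    (hY : ∀ n ≠ 0, counit K (PowerSeries.coeff n Y) = 0) {n : ℕ} (hn : n ≠ 0) :
    linPart d (PowerSeries.coeff n W) = linPart d (PowerSeries.coeff n Y) := by
  have hnat : ∀ (m : ℕ) (x : HCK K), linPart d (((m : HCK K) + 1) * x) =
      ((m : K) + 1) • linPart d x := by
    intro m x
    rw [← map_smul, Algebra.smul_def]
    simp
  have hW : ∀ m ≠ 0, counit K (PowerSeries.coeff m W) = 0 := by
    intro m hm
    obtain ⟨m, rfl⟩ := Nat.exists_eq_succ_of_ne_zero hm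
    have := congrArg (counit K) (h.coeff_succ m)
    rw [map_sum, Finset.sum_eq_zero (fun p _ => by simp [hY])] at this
    have hm0 : (m : K) + 1 ≠ 0 := by exact_mod_cast m.succ_ne_zero
    simpa [hm0] using this
  obtain ⟨n, rfl⟩ := Nat.exists_eq_succ_of_ne_zero hn
  have := congrArg (linPart d) (h.coeff_succ n)
  rw [map_sum, Finset.sum_eq_single (n, 0), hnat] at this
  · have hn0 : (n : K) + 1 ≠ 0 := by exact_mod_cast n.succ_ne_zero
    refine smul_right_injective M hn0 ?_
    simp only
    rw [Nat.succ_eq_add_one, this]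
    simp [h.constantCoeff, hnat]
  · rintro ⟨i, j⟩ hp hne
    have hj : j ≠ 0 := by
      rintro rfl
      simp at hp
      simp [hp] at hne
    rw [linPart_mul, hW _ hj, zero_smul, add_zero, map_mul, hY _ (by simp), mul_zero, zero_smul]
  · simp

/-! ## The grading -/

variable (K) in
/-- The span of the forests with `n` vertices. -/
noncomputable def forestSpan (n : ℕ) : Submodule K (HCK K) :=
  Submodule.span K {x | ∃ F : Multiset RTree, (F.map RTree.size).sum = n ∧ x = forest K F}

variable (K) in
/-- The span of the trees with `n` vertices. -/
noncomputable def treeSpan (n : ℕ) : Submodule K (HCK K) :=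
  Submodule.span K {x | ∃ s : RTree, s.size = n ∧ x = MvPolynomial.X s}

theorem forest_mem_forestSpan (F : Multiset RTree) :
    forest K F ∈ forestSpan K (F.map RTree.size).sum :=
  Submodule.subset_span ⟨F, rfl, rfl⟩

theorem X_mem_treeSpan (s : RTree) : (MvPolynomial.X s : HCK K) ∈ treeSpan K s.size :=
  Submodule.subset_span ⟨s, rfl, rfl⟩

theorem one_mem_forestSpan : (1 : HCK K) ∈ forestSpan K 0 := forest_mem_forestSpan 0

theorem mul_mem_forestSpan {m n : ℕ} {x y : HCK K} (hx : x ∈ forestSpan K m)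
    (hy : y ∈ forestSpan K n) : x * y ∈ forestSpan K (m + n) := by
  have h := Submodule.mul_mem_mul hx hy
  rw [forestSpan, forestSpan, Submodule.span_mul_span] at h
  refine Submodule.span_mono ?_ h
  rintro _ ⟨_, ⟨F, rfl, rfl⟩, _, ⟨G, rfl, rfl⟩, rfl⟩
  exact ⟨F + G, by simp, (forest_add F G).symm⟩

theorem addRoot_mem_treeSpan {n : ℕ} {x : HCK K} (hx : x ∈ forestSpan K n) :
    addRoot K x ∈ treeSpan K (n + 1) := by
  induction hx using Submodule.span_induction with
  | zero => simp
  | add x y _ _ hx hy => rw [map_add]; exact add_mem hx hy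
  | smul a x _ hx => rw [map_smul]; exact Submodule.smul_mem _ a hx
  | mem x hx =>
    obtain ⟨F, rfl, rfl⟩ := hx
    rw [addRoot_forest, ← size_node]
    exact X_mem_treeSpan _

theorem treeSpan_le_forestSpan (n : ℕ) : treeSpan K n ≤ forestSpan K n := by
  refine Submodule.span_mono ?_
  rintro _ ⟨s, rfl, rfl⟩
  exact ⟨{s}, by simp, by simp⟩

theorem linPart_eq_zero_of_mem_forestSpan {M : Type*} [AddCommGroup M] [Module K M]
    {d : RTree → M} {n : ℕ} {x : HCK K} (hx : x ∈ forestSpan K n)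
    (hd : ∀ t : RTree, t.size = n → d t = 0) : linPart d x = 0 := by
  induction hx using Submodule.span_induction with
  | zero => simp
  | add x y _ _ hx hy => rw [map_add, hx, hy, add_zero]
  | smul a x _ hx => rw [map_smul, hx, smul_zero]
  | mem x hx =>
    obtain ⟨F, rfl, rfl⟩ := hx
    rw [linPart_forest]
    split_ifs with h
    · obtain ⟨t, rfl⟩ := Multiset.card_eq_one.1 h
      simpa using hd t (by simp)
    · rfl

theorem counit_eq_zero_of_mem_forestSpan {n : ℕ} {x : HCK K} (hx : x ∈ forestSpan K n)
    (hn : n ≠ 0) : counit K x = 0 := by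
  induction hx using Submodule.span_induction with
  | zero => simp
  | add x y _ _ hx hy => rw [map_add, hx, hy, add_zero]
  | smul a x _ hx => rw [map_smul, hx, smul_zero]
  | mem x hx =>
    classical
    obtain ⟨F, rfl, rfl⟩ := hx
    rw [counit_forest, if_neg]
    rintro rfl
    exact hn rfl

theorem ladder_mem_forestSpan (n : ℕ) : ladder K n ∈ forestSpan K n := by
  induction n with
  | zero => exact one_mem_forestSpan
  | succ n ih => exact treeSpan_le_forestSpan _ (addRoot_mem_treeSpan ih)

theorem ladderLog_mem_forestSpan (n : ℕ) : ladderLog K n ∈ forestSpan K n := by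
  refine Submodule.sum_mem _ fun c _ => Submodule.smul_mem _ _ ?_
  have h : ∀ l : List ℕ, (l.map (ladder K)).prod ∈ forestSpan K l.sum := by
    intro l
    induction l with
    | nil => exact one_mem_forestSpan
    | cons a l ih => simpa using mul_mem_forestSpan (ladder_mem_forestSpan a) ih
  simpa [c.blocks_sum] using h c.blocks

theorem ladderLog_mem_of_ladder_mem (A : Subalgebra K (HCK K)) {n : ℕ}
    (h : ∀ j ≤ n, ladder K j ∈ A) : ladderLog K n ∈ A := by
  refine sum_mem fun c _ => A.smul_mem (A.list_prod_mem fun x hx => ?_) _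
  obtain ⟨j, hj, rfl⟩ := List.mem_map.1 hx
  exact h j (c.blocks_sum ▸ List.single_le_sum (by simp) j hj)

theorem mem_of_natCast_succ_mul_mem [CharZero K] (S : Submodule K (HCK K)) {n : ℕ} {x : HCK K}
    (h : ((n : HCK K) + 1) * x ∈ S) : x ∈ S := by
  have hK : (n : K) + 1 ≠ 0 := by exact_mod_cast n.succ_ne_zero
  rw [← S.smul_mem_iff hK, Algebra.smul_def]
  simpa using h

theorem natCast_succ_mul_mem (S : Submodule K (HCK K)) (n : ℕ) {x : HCK K} (h : x ∈ S) :
    ((n : HCK K) + 1) * x ∈ S := by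
  convert S.smul_mem ((n : K) + 1) h using 1
  rw [Algebra.smul_def]
  simp

theorem IsExp.coeff_mem_forestSpan [CharZero K] {Y W : PowerSeries (HCK K)} (h : IsExp Y W)
    (hY : ∀ n, PowerSeries.coeff n Y ∈ forestSpan K n) (n : ℕ) :
    PowerSeries.coeff n W ∈ forestSpan K n := by
  induction n using Nat.strong_induction_on with
  | _ n ih =>
    cases n with
    | zero => simpa [h.constantCoeff] using one_mem_forestSpan
    | succ n =>
      refine mem_of_natCast_succ_mul_mem _ (n := n) ?_
      rw [h.coeff_succ]
      refine sum_mem fun p hp => ?_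
      have hp := mem_antidiagonal.1 hp
      have := mul_mem_forestSpan (natCast_succ_mul_mem _ p.1 (hY (p.1 + 1)))
        (ih p.2 (by omega))
      rwa [show p.1 + 1 + p.2 = n + 1 by omega] at this

theorem IsExp.coeff_mem_subalgebra [CharZero K] {Y W : PowerSeries (HCK K)} (h : IsExp Y W)
    (A : Subalgebra K (HCK K)) (hY : ∀ n, PowerSeries.coeff n Y ∈ A) (n : ℕ) :
    PowerSeries.coeff n W ∈ A := by
  induction n using Nat.strong_induction_on with
  | _ n ih =>
    cases n with
    | zero => simp [h.constantCoeff]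
    | succ n =>
      refine mem_of_natCast_succ_mul_mem (Subalgebra.toSubmodule A) (n := n) ?_
      rw [h.coeff_succ]
      refine sum_mem fun p hp => ?_
      have hp := mem_antidiagonal.1 hp
      exact A.mul_mem (natCast_succ_mul_mem (Subalgebra.toSubmodule A) p.1 (hY (p.1 + 1)))
        (ih p.2 (by omega))

/-! ## Strong sequences from group-like sequences -/

variable (K) in
/-- The linear map sending the one-vertex tree to `1` and all other forests to `0`. -/
noncomputable def leafPart : HCK K →ₗ[K] K :=
  open Classical in linPart (Pi.single leaf 1)

@[simp] theorem leafPart_leaf : leafPart K (MvPolynomial.X leaf) = 1 := by simp [leafPart]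

theorem leafPart_addRoot (x : HCK K) : leafPart K (addRoot K x) = counit K x := by
  classical
  suffices h : leafPart K ∘ₗ addRoot K = (counit K).toLinearMap from LinearMap.congr_fun h x
  refine linearMap_ext_forest fun F => ?_
  rw [LinearMap.comp_apply, leafPart, linPart_addRoot_forest, AlgHom.toLinearMap_apply,
    counit_forest]
  split_ifs with h
  · subst h
    exact Pi.single_eq_same _ _
  · refine Pi.single_eq_of_ne (fun h' => h ?_) _
    have := size_node F
    rw [h', size_leaf] at this
    exact eq_zero_of_sum_size_eq_zero (by omega)

/-- The one-vertex functional composed with B₊ is the counit, so by the cocycle identity contraction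
with it inverts B₊ on the left. -/
theorem contractRight_leafPart_addRoot (x : HCK K) :
    contractRight (leafPart K) (addRoot K x) = x := by
  have h : leafPart K 1 = 0 := by simp [leafPart]
  rw [contractRight_apply, comul_addRoot, map_add, map_add, LinearMap.lTensor_tmul, h]
  conv_rhs => rw [← contractRight_counit x, contractRight_apply]
  rw [TensorProduct.tmul_zero, map_zero, zero_add]
  induction comul K x with
  | zero => simp
  | add a b ha hb => simp only [map_add, ha, hb]
  | tmul a b => simp [leafPart_addRoot]

theorem addRoot_injective : Function.Injective (addRoot K) :=
  Function.LeftInverse.injective contractRight_leafPart_addRoot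

/-- A group-like sequence whose image under `B₊` is a strong 0th order sequence. -/
structure IsGenerating (x : ℕ → HCK K) : Prop extends IsGroupLikeSeq x where
  mem_forestSpan : ∀ n, x n ∈ forestSpan K n
  mem_adjoin : ∀ n, x n ∈ Algebra.adjoin K (Set.range fun k => addRoot K (x k))
  one : ∃ c : K, c ≠ 0 ∧ x 1 = c • MvPolynomial.X leaf

namespace IsGroupLikeSeq

variable {x : ℕ → HCK K}

theorem comul_addRoot (hx : IsGroupLikeSeq x) (n : ℕ) :
    CK.comul K (addRoot K (x n)) = addRoot K (x n) ⊗ₜ[K] 1 +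
      ∑ p ∈ antidiagonal n, x p.1 ⊗ₜ[K] addRoot K (x p.2) := by
  rw [CK.comul_addRoot, hx.comul, map_sum]
  rfl

theorem contractLeft_addRoot (hx : IsGroupLikeSeq x) (f : HCK K →ₗ[K] K) (n : ℕ) :
    contractLeft f (addRoot K (x n)) = f (addRoot K (x n)) • 1 +
      ∑ p ∈ antidiagonal n, f (x p.1) • addRoot K (x p.2) := by
  rw [contractLeft_apply, hx.comul_addRoot]
  simp

theorem rescale (hx : IsGroupLikeSeq x) (α : K) :
    IsGroupLikeSeq fun n => α ^ n • x n where
  zero := by simp [hx.zero]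
  comul n := by
    rw [map_smul, hx.comul, Finset.smul_sum]
    refine Finset.sum_congr rfl fun p hp => ?_
    rw [TensorProduct.smul_tmul_smul, ← pow_add, mem_antidiagonal.1 hp]

theorem sum_antipode_mul (hx : IsGroupLikeSeq x) (n : ℕ) :
    ∑ p ∈ antidiagonal n, antipode K (x p.1) * x p.2 = algebraMap K _ (counit K (x n)) := by
  have h := DFunLike.congr_fun (antipode_comp_comul (K := K)) (x n)
  simp only [AlgHom.comp_apply, hx.comul, map_sum] at h
  simpa using h

end IsGroupLikeSeq

theorem tmul_mem_range {A : Subalgebra K (HCK K)} {a b : HCK K} (ha : a ∈ A) (hb : b ∈ A) :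
    a ⊗ₜ[K] b ∈ (Algebra.TensorProduct.map A.val A.val).range :=
  ⟨⟨a, ha⟩ ⊗ₜ ⟨b, hb⟩, by simp⟩

namespace IsGenerating

variable {x : ℕ → HCK K}

/-- For n > 0, group-likeness gives ∑ S(x_p) x_q = 0 over p + q = n, which expresses S(x_n) through
earlier antipodes and the x_q, all in the subalgebra. -/
theorem antipode_mem (hx : IsGenerating x) (n : ℕ) :
    antipode K (x n) ∈ Algebra.adjoin K (Set.range fun k => addRoot K (x k)) := by
  induction n using Nat.strong_induction_on with
  | _ n ih =>
    rcases eq_or_ne n 0 with rfl | hn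
    · rw [hx.zero, map_one]
      exact one_mem _
    have h := hx.sum_antipode_mul n
    rw [counit_eq_zero_of_mem_forestSpan (hx.mem_forestSpan n) hn, map_zero,
      ← Finset.add_sum_erase _ _
      (mem_antidiagonal.2 (by simp) : (n, 0) ∈ antidiagonal n), hx.zero, mul_one] at h
    rw [eq_neg_of_add_eq_zero_left h]
    refine neg_mem (sum_mem fun p hp => mul_mem (ih _ ?_) (hx.mem_adjoin _))
    obtain ⟨h1, h2⟩ := Finset.mem_erase.1 hp
    have h2 := mem_antidiagonal.1 h2
    by_contra h3
    exact h1 (Prod.ext (by simp only; omega) (by simp only; omega))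

theorem isHopfSubalgebra (hx : IsGenerating x) :
    IsHopfSubalgebra (Algebra.adjoin K (Set.range fun k => addRoot K (x k))) := by
  set A := Algebra.adjoin K (Set.range fun k => addRoot K (x k)) with hA
  have ht : ∀ k, addRoot K (x k) ∈ A := fun k => Algebra.subset_adjoin ⟨k, rfl⟩
  constructor
  · suffices h : A ≤ ((Algebra.TensorProduct.map A.val A.val).range).comap (comul K) from
      fun a ha => h ha
    rw [hA, Algebra.adjoin_le_iff]
    rintro _ ⟨n, rfl⟩
    change comul K (addRoot K (x n)) ∈ (Algebra.TensorProduct.map A.val A.val).range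
    rw [hx.comul_addRoot]
    exact add_mem (tmul_mem_range (ht n) (one_mem _))
      (sum_mem fun p _ => tmul_mem_range (hx.mem_adjoin _) (ht _))
  · suffices h : A ≤ A.comap (antipode K) from fun a ha => h ha
    nth_rewrite 1 [hA]
    rw [Algebra.adjoin_le_iff]
    rintro _ ⟨n, rfl⟩
    change antipode K (addRoot K (x n)) ∈ A
    have h := DFunLike.congr_fun (antipode_comp_comul (K := K)) (addRoot K (x n))
    simp only [AlgHom.comp_apply, hx.comul_addRoot, map_add, map_sum, counit_addRoot,
      map_zero, Algebra.TensorProduct.map_tmul, Algebra.TensorProduct.lmul'_apply_tmul,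
      AlgHom.id_apply, mul_one] at h
    rw [eq_neg_of_add_eq_zero_left h]
    exact neg_mem (sum_mem fun p _ => mul_mem (hx.antipode_mem _) (ht _))

/-- Contraction with the one-vertex functional sends x_{n+1} to c x_n with c ≠ 0, so a vanishing
term would force all earlier ones, including x_0 = 1, to vanish. -/
theorem ne_zero (hx : IsGenerating x) (n : ℕ) : x n ≠ 0 := by
  obtain ⟨c, hc, h1⟩ := hx.one
  have hleaf : ∀ m ≠ 1, leafPart K (x m) = 0 := by
    intro m hm
    classical
    rw [leafPart]
    refine linPart_eq_zero_of_mem_forestSpan (hx.mem_forestSpan m) fun t ht => ?_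
    refine Pi.single_eq_of_ne ?_ _
    rintro rfl
    exact hm (by simpa using ht.symm)
  induction n with
  | zero => rw [hx.zero]; exact one_ne_zero
  | succ n ih =>
    intro h
    have h2 : contractRight (leafPart K) (x (n + 1)) = c • x n := by
      rw [contractRight_apply, hx.comul, map_sum, map_sum, Finset.sum_eq_single (n, 1)]
      · simp [h1]
      · rintro ⟨a, b⟩ hp hne
        have hb : b ≠ 1 := by
          rintro rfl
          exact hne (Prod.ext (by have := mem_antidiagonal.1 hp; simp only at this ⊢; omega) rfl)
        simp [hleaf b hb]
      · simp
    rw [h, map_zero] at h2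
    exact smul_ne_zero hc ih h2.symm

theorem range_eq : (Set.range fun n : ℕ+ => addRoot K (x ((n : ℕ) - 1))) =
    Set.range fun k => addRoot K (x k) := by
  ext y
  constructor
  · rintro ⟨n, rfl⟩
    exact ⟨_, rfl⟩
  · rintro ⟨k, rfl⟩
    exact ⟨k.succPNat, by simp⟩

theorem isSeq (hx : IsGenerating x) : IsSeq fun n : ℕ+ => addRoot K (x ((n : ℕ) - 1)) where
  ne_zero n := (map_ne_zero_iff _ addRoot_injective).2 (hx.ne_zero _)
  mem_span n := by
    have := addRoot_mem_treeSpan (hx.mem_forestSpan ((n : ℕ) - 1))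
    rwa [Nat.sub_add_cancel n.pos] at this
  one := by simp [hx.zero]
  hopf := by
    rw [range_eq]
    exact hx.isHopfSubalgebra

theorem isStrong [CharZero K] (hx : IsGenerating x) :
    IsStrong 0 fun n : ℕ+ => addRoot K (x ((n : ℕ) - 1)) := by
  refine ⟨hx.isSeq, fun φ hφ => ?_⟩
  set δ : HCK K →ₗ[K] K := linPart fun t => (φ (MvPolynomial.X t)).coeff 1 with hδ
  obtain ⟨c, hc, h1⟩ := hx.one
  -- The coproduct of B₊(x_n) dictates β_n = δ(x_n). The constant term 1 of the Green function
  -- contributes an extra β_n in degree n, which γ₀ subtracts again.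
  refine ⟨fun _ => PowerSeries.mk fun n => δ (x n), PowerSeries.mk fun n =>
    if n = 0 then 0 else δ (addRoot K (x (n - 1))) - δ (x n), ⟨fun j hj => ?_, ?_⟩, fun hleaf => ?_⟩
  · obtain rfl : j = 0 := by omega
    rw [zero_add, pow_one, PowerSeries.X_dvd_iff, ← PowerSeries.coeff_zero_eq_constantCoeff_apply,
      PowerSeries.coeff_mk, hx.zero, hδ, linPart_one]
  · rw [zero_add, Finset.sum_range_one, Function.iterate_zero, id]
    ext1 n
    rw [derivL, PowerSeries.coeff_mk, map_add, PowerSeries.coeff_mul]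
    simp only [constL, PowerSeries.coeff_map, PowerSeries.coeff_mk, green]
    cases n with
    | zero => simp [hx.zero, hδ]
    | succ n =>
      rw [Finset.Nat.antidiagonal_succ', Finset.sum_cons, Finset.sum_map]
      have hmap : ∀ p : ℕ × ℕ, (Function.Embedding.refl ℕ).prodMap
          ⟨Nat.succ, Nat.succ_injective⟩ p = (p.1, p.2 + 1) := fun _ => rfl
      simp only [hmap, Nat.succ_pos, dif_pos, lt_irrefl, dif_neg, not_false_eq_true, PNat.mk_coe,
        Nat.add_sub_cancel, Nat.succ_ne_zero, if_false, mul_one]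
      rw [hφ.derivative, hx.contractLeft_addRoot, map_add, map_smul, map_one, map_sum,
        Polynomial.smul_eq_C_mul, mul_one, map_sub]
      simp only [map_smul, Polynomial.smul_eq_C_mul]
      ring
  · rw [zero_add, PowerSeries.coeff_mk, h1, map_smul, smul_eq_mul]
    -- If δ vanishes on the vertex, then φ of the vertex has zero derivative and zero constant term.
    refine mul_ne_zero hc fun h => hleaf ?_
    have hd := hφ.derivative (MvPolynomial.X leaf)
    rw [← hδ, ← addRoot_one, ← hx.zero, hx.contractLeft_addRoot, hx.zero, addRoot_one, h] at hd
    have hi := polyIntegral_derivative (φ (MvPolynomial.X leaf))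
    rw [hφ.coeff_zero, counit_X, hd] at hi
    simpa [hx.zero, hδ] using hi.symm

theorem rescale (hx : IsGenerating x) {α : K} (hα : α ≠ 0) :
    IsGenerating fun n => α ^ n • x n where
  toIsGroupLikeSeq := hx.toIsGroupLikeSeq.rescale α
  mem_forestSpan n := Submodule.smul_mem _ _ (hx.mem_forestSpan n)
  mem_adjoin n := by
    refine Subalgebra.smul_mem _ (Algebra.adjoin_le ?_ (hx.mem_adjoin n)) _
    rintro _ ⟨k, rfl⟩
    have : addRoot K (x k) = (α ^ k)⁻¹ • addRoot K (α ^ k • x k) := by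
      rw [map_smul, inv_smul_smul₀ (pow_ne_zero k hα)]
    simp only [SetLike.mem_coe]
    rw [this]
    exact Subalgebra.smul_mem _ (Algebra.subset_adjoin (Set.mem_range_self k)) _
  one := by
    obtain ⟨c, hc, h1⟩ := hx.one
    exact ⟨α * c, mul_ne_zero hα hc, by rw [h1, pow_one, mul_smul]⟩

theorem isStrong_rescaleSeq [CharZero K] (hx : IsGenerating x) {α : K} (hα : α ≠ 0) :
    IsStrong 0 (rescaleSeq α fun n : ℕ+ => addRoot K (x ((n : ℕ) - 1))) := by
  convert (hx.rescale hα).isStrong using 2 with n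
  rw [map_smul, rescaleSeq]

end IsGenerating

theorem ladder_isGenerating : IsGenerating (ladder K) where
  toIsGroupLikeSeq := ladder_isGroupLikeSeq
  mem_forestSpan := ladder_mem_forestSpan
  mem_adjoin n := by
    cases n with
    | zero => exact one_mem _
    | succ n => exact Algebra.subset_adjoin ⟨n, rfl⟩
  one := ⟨1, one_ne_zero, by simp [ladder]⟩

/-! ### The group-like series exp(p_1 + … + p_{n-1} + b p_n) -/

theorem coeff_zExponent (n : ℕ+) (b : K) (k : ℕ) : PowerSeries.coeff k (zExponent n b) =
    if k = 0 then 0 else if k < n then ladderLog K k else if k = n then b • ladderLog K k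
      else 0 := by
  rw [zExponent, map_add, map_sum]
  simp only [PowerSeries.coeff_monomial]
  rw [Finset.sum_ite_eq]
  have := n.pos
  rcases lt_trichotomy k n with h | h | h
  · rcases Nat.eq_zero_or_pos k with rfl | h0
    · simp [this.ne]
    · simp [h, h.ne, h0.ne', Nat.one_le_iff_ne_zero]
  · subst h
    simp
  · simp [h.not_gt, h.ne', (this.trans h).ne']

/-- The components of `exp (p_1 + … + p_{n-1} + b p_n)`. -/
noncomputable def zComponent [CharZero K] (n : ℕ+) (b : K) (k : ℕ) : HCK K :=
  PowerSeries.coeff k ((PowerSeries.exp K).subst (zExponent n b))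

section CharZero

variable [CharZero K] (n : ℕ+) (b : K)

theorem isExp_zExponent : IsExp (zExponent n b) ((PowerSeries.exp K).subst (zExponent n b)) :=
  isExp_exp_subst K (by
    rw [← PowerSeries.coeff_zero_eq_constantCoeff_apply, coeff_zExponent, if_pos rfl])

/-- Below degree n the exponent agrees with the logarithm of the ladder series. -/
theorem zComponent_eq_ladder {k : ℕ} (hk : k < n) : zComponent n b k = ladder K k := by
  have := (isExp_zExponent n b).unique K (isExp_ladder (K := K)) k (fun m hm hm0 => by
    rw [coeff_zExponent, if_neg hm0, if_pos (by omega), ladderLogSeries, PowerSeries.coeff_mk])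
    k le_rfl
  simpa [ladderSeries, zComponent] using this

theorem zExponent_primitive {k : ℕ} (hk : k ≠ 0) : comul K (PowerSeries.coeff k (zExponent n b)) =
    PowerSeries.coeff k (zExponent n b) ⊗ₜ[K] 1 + 1 ⊗ₜ[K] PowerSeries.coeff k (zExponent n b) := by
  rw [coeff_zExponent, if_neg hk]
  split_ifs with h1 h2
  · exact ladderLog_primitive hk
  · rw [map_smul, ladderLog_primitive hk, smul_add, TensorProduct.smul_tmul',
      TensorProduct.tmul_smul]
  · simp

theorem linPart_ladderLog {k : ℕ} (hk : k ≠ 0) {M : Type*} [AddCommGroup M] [Module K M]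
    (d : RTree → M) : linPart d (ladderLog K k) = linPart d (ladder K k) := by
  have := (isExp_ladder (K := K)).linPart_coeff d (fun n hn => by
    rw [ladderLogSeries, PowerSeries.coeff_mk]
    exact counit_of_primitive (ladderLog_primitive hn)) hk
  simpa [ladderSeries, ladderLogSeries] using this.symm

theorem linPart_zComponent {k : ℕ} (hk : k ≠ 0) {M : Type*} [AddCommGroup M] [Module K M]
    (d : RTree → M) : linPart d (zComponent n b k) =
      (if k < n then 1 else if k = n then b else 0 : K) • linPart d (ladder K k) := by
  have := (isExp_zExponent n b).linPart_coeff d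
    (fun m hm => counit_of_primitive (zExponent_primitive n b hm)) hk
  rw [zComponent, this, coeff_zExponent, if_neg hk]
  split_ifs <;> simp [linPart_ladderLog hk]

theorem zComponent_isGroupLikeSeq : IsGroupLikeSeq (zComponent n b) :=
  (isExp_zExponent n b).isGroupLikeSeq fun _ => zExponent_primitive n b

theorem zComponent_isGenerating (hb : b ≠ 0) : IsGenerating (zComponent n b) where
  toIsGroupLikeSeq := zComponent_isGroupLikeSeq n b
  mem_forestSpan := (isExp_zExponent n b).coeff_mem_forestSpan fun k => by
    rw [coeff_zExponent]
    split_ifs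
    · exact zero_mem _
    · exact ladderLog_mem_forestSpan k
    · exact Submodule.smul_mem _ _ (ladderLog_mem_forestSpan k)
    · exact zero_mem _
  mem_adjoin := by
    refine (isExp_zExponent n b).coeff_mem_subalgebra _ fun k => ?_
    -- The p_k occurring in the exponent are polynomials in ladders with at most n vertices. A
    -- ladder with j + 1 ≤ n vertices is B₊ of the component of degree j, because that component is
    -- still ℓ_j.
    have hlad : ∀ k ≤ (n : ℕ), ladderLog K k ∈
        Algebra.adjoin K (Set.range fun k => addRoot K (zComponent n b k)) := by
      intro k hk
      refine ladderLog_mem_of_ladder_mem _ fun j hj => ?_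
      cases j with
      | zero => exact one_mem _
      | succ j =>
        rw [ladder, ← zComponent_eq_ladder n b (show j < n by omega)]
        exact Algebra.subset_adjoin ⟨j, rfl⟩
    rw [coeff_zExponent]
    split_ifs with h1 h2 h3
    · exact zero_mem _
    · exact hlad k h2.le
    · exact Subalgebra.smul_mem _ (hlad k h3.le) _
    · exact zero_mem _
  one := by
    have h1 : ladderLog K 1 = MvPolynomial.X leaf := by
      have := (isExp_ladder (K := K)).coeff_succ 0
      simpa [ladderSeries, ladderLogSeries, ladder] using this.symm
    have h := (isExp_zExponent n b).coeff_succ 0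
    simp only [Nat.cast_zero, zero_add, one_mul, Finset.Nat.antidiagonal_zero,
      Finset.sum_singleton, PowerSeries.coeff_zero_eq_constantCoeff_apply,
      (isExp_zExponent n b).constantCoeff, mul_one, coeff_zExponent, one_ne_zero, if_false, h1] at h
    rw [zComponent, h]
    have := n.pos
    split_ifs with h2 h3
    · exact ⟨1, one_ne_zero, (one_smul _ _).symm⟩
    · exact ⟨b, hb, rfl⟩
    · omega

theorem zSeq_eq : zSeq n b = fun k : ℕ+ => addRoot K (zComponent n b ((k : ℕ) - 1)) := rfl

theorem isStrong_rescaleSeq_zSeq (hb : b ≠ 0) {α : K} (hα : α ≠ 0) :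
    IsStrong 0 (rescaleSeq α (zSeq n b)) :=
  (zComponent_isGenerating n b hb).isStrong_rescaleSeq hα

end CharZero

theorem ladder_eq_addRoot :
    (fun n : ℕ+ => ladder K n) = fun n : ℕ+ => addRoot K (ladder K ((n : ℕ) - 1)) := by
  funext n
  obtain ⟨k, hk⟩ := Nat.exists_eq_succ_of_ne_zero n.ne_zero
  rw [hk]
  rfl

theorem isStrong_rescaleSeq_ladder [CharZero K] {α : K} (hα : α ≠ 0) :
    IsStrong 0 (rescaleSeq α fun n => ladder K n) := by
  rw [ladder_eq_addRoot]
  exact ladder_isGenerating.isStrong_rescaleSeq hα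

/-! ## Sequences generating a Hopf subalgebra -/

theorem linPart_congr_of_mem_forestSpan {M : Type*} [AddCommGroup M] [Module K M]
    {d d' : RTree → M} {n : ℕ} {x : HCK K} (hx : x ∈ forestSpan K n)
    (h : ∀ t : RTree, t.size = n → d t = d' t) : linPart d x = linPart d' x := by
  induction hx using Submodule.span_induction with
  | zero => simp
  | add x y _ _ hx hy => rw [map_add, map_add, hx, hy]
  | smul a x _ hx => rw [map_smul, map_smul, hx]
  | mem x hx =>
    obtain ⟨F, rfl, rfl⟩ := hx
    rw [linPart_forest, linPart_forest]
    split_ifs with h1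
    · obtain ⟨t, rfl⟩ := Multiset.card_eq_one.1 h1
      simpa using h t (by simp)
    · rfl

theorem linPart_X_of_mem_treeSpan {n : ℕ} {x : HCK K} (hx : x ∈ treeSpan K n) :
    linPart MvPolynomial.X x = x := by
  induction hx using Submodule.span_induction with
  | zero => simp
  | add x y _ _ hx hy => rw [map_add, hx, hy]
  | smul a x _ hx => rw [map_smul, hx]
  | mem x hx =>
    obtain ⟨s, rfl, rfl⟩ := hx
    simp

theorem exists_addRoot_eq_of_mem_treeSpan {n : ℕ} {x : HCK K} (hx : x ∈ treeSpan K n) :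
    ∃ y, addRoot K y = x := by
  suffices h : treeSpan K n ≤ LinearMap.range (addRoot K) from h hx
  refine Submodule.span_le.2 ?_
  rintro _ ⟨s, rfl, rfl⟩
  obtain ⟨F, rfl⟩ := node_surjective s
  exact ⟨forest K F, addRoot_forest F⟩

theorem eq_counit_of_mem_forestSpan_zero {x : HCK K} (hx : x ∈ forestSpan K 0) :
    x = counit K x • 1 := by
  induction hx using Submodule.span_induction with
  | zero => simp
  | add x y _ _ hx hy => rw [map_add, add_smul, ← hx, ← hy]
  | smul a x _ hx => rw [map_smul, smul_assoc, ← hx]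
  | mem x hx =>
    obtain ⟨F, hF, rfl⟩ := hx
    simp [eq_zero_of_sum_size_eq_zero hF]

theorem exists_dual_of_mem_treeSpan {n : ℕ} {x : HCK K} (hx : x ∈ treeSpan K n) (h0 : x ≠ 0) :
    ∃ d : RTree → K, (∀ t : RTree, t.size ≠ n → d t = 0) ∧ linPart d x = 1 := by
  classical
  have h : ∀ m, (∀ s : RTree, s.size = n → m ≠ Finsupp.single s 1) →
      MvPolynomial.coeff m x = 0 := by
    intro m hm
    clear h0
    induction hx using Submodule.span_induction with
    | zero => simp
    | add x y _ _ hx hy => rw [MvPolynomial.coeff_add, hx, hy, add_zero]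
    | smul a x _ hx => rw [MvPolynomial.coeff_smul, hx, smul_zero]
    | mem x hx =>
      obtain ⟨s, hs, rfl⟩ := hx
      rw [MvPolynomial.coeff_X, if_neg (hm s hs).symm]
  obtain ⟨m, hm⟩ := MvPolynomial.ne_zero_iff.1 h0
  obtain ⟨s, hs, rfl⟩ : ∃ s : RTree, s.size = n ∧ m = Finsupp.single s 1 := by
    by_contra hcon
    push Not at hcon
    exact hm (h m hcon)
  refine ⟨fun t => if t = s then (MvPolynomial.coeff (Finsupp.single s 1) x)⁻¹ else 0,
    fun t ht => if_neg (by rintro rfl; exact ht hs), ?_⟩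
  have : linPart (fun t => if t = s then (MvPolynomial.coeff (Finsupp.single s 1) x)⁻¹ else 0) =
      (MvPolynomial.coeff (Finsupp.single s 1) x)⁻¹ •
        (linPart (Pi.single s 1) : HCK K →ₗ[K] K) := by
    refine linearMap_ext_forest fun F => ?_
    rw [LinearMap.smul_apply, linPart_forest, linPart_forest]
    split_ifs with h1
    · obtain ⟨t, rfl⟩ := Multiset.card_eq_one.1 h1
      simp [Pi.single_apply]
    · simp
  rw [this, LinearMap.smul_apply, linPart_single, smul_eq_mul, inv_mul_cancel₀ hm]

theorem contractRight_linPart_X (d : RTree → K) (t : RTree) :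
    contractRight (linPart d) (MvPolynomial.X t) =
      (t.cuts.map fun q => d q.2 • forest K q.1).sum := by
  rw [contractRight_apply, comul_X, map_add, map_add, map_multiset_sum, map_multiset_sum,
    Multiset.map_map, Multiset.map_map]
  simp [Function.comp_def]

theorem contractRight_mem_forestSpan {d : RTree → K} {k n : ℕ}
    (hd : ∀ t : RTree, t.size ≠ k → d t = 0) {x : HCK K} (hx : x ∈ treeSpan K (n + k)) :
    contractRight (linPart d) x ∈ forestSpan K n := by
  induction hx using Submodule.span_induction with
  | zero => simp
  | add x y _ _ hx hy => rw [map_add]; exact add_mem hx hy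
  | smul a x _ hx => rw [map_smul]; exact Submodule.smul_mem _ a hx
  | mem x hx =>
    obtain ⟨s, hs, rfl⟩ := hx
    rw [contractRight_linPart_X]
    refine multiset_sum_mem _ fun y hy => ?_
    obtain ⟨q, hq, rfl⟩ := Multiset.mem_map.1 hy
    by_cases h : q.2.size = k
    · have := s.size_add_of_mem_cuts q hq
      obtain rfl : (q.1.map RTree.size).sum = n := by omega
      exact Submodule.smul_mem _ _ (forest_mem_forestSpan _)
    · rw [hd _ h, zero_smul]
      exact zero_mem _

theorem contractRight_eq_zero {d : RTree → K} {k n : ℕ} (hnk : n < k)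
    (hd : ∀ t : RTree, t.size ≠ k → d t = 0) {x : HCK K} (hx : x ∈ treeSpan K n) :
    contractRight (linPart d) x = 0 := by
  induction hx using Submodule.span_induction with
  | zero => simp
  | add x y _ _ hx hy => rw [map_add, hx, hy, add_zero]
  | smul a x _ hx => rw [map_smul, hx, smul_zero]
  | mem x hx =>
    obtain ⟨s, hs, rfl⟩ := hx
    rw [contractRight_linPart_X]
    refine Multiset.sum_eq_zero fun y hy => ?_
    obtain ⟨q, hq, rfl⟩ := Multiset.mem_map.1 hy
    have := s.size_add_of_mem_cuts q hq
    rw [hd _ (by omega), zero_smul]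

theorem contractRight_mem_of_comul_mem {A : Subalgebra K (HCK K)} {x : HCK K}
    (hx : comul K x ∈ (Algebra.TensorProduct.map A.val A.val).range) (f : HCK K →ₗ[K] K) :
    contractRight f x ∈ A := by
  obtain ⟨w, hw⟩ := hx
  rw [contractRight_apply, ← hw]
  change TensorProduct.rid K _ (f.lTensor _ (Algebra.TensorProduct.map A.val A.val w)) ∈ A
  clear hw
  induction w with
  | zero => simp
  | add a b ha hb => simp only [map_add]; exact add_mem ha hb
  | tmul a b => simpa using A.smul_mem a.2 (f b)

/-- A cut leaves a single tree containing the root, so apart from x ⊗ 1 the right factors of the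
coproduct are already linear. -/
theorem lTensor_linPart_comul_of_mem_treeSpan {n : ℕ} {x : HCK K} (hx : x ∈ treeSpan K n) :
    comul K x = x ⊗ₜ[K] 1 + (linPart MvPolynomial.X).lTensor (HCK K) (comul K x) := by
  obtain ⟨y, rfl⟩ := exists_addRoot_eq_of_mem_treeSpan hx
  have h : (linPart MvPolynomial.X : HCK K →ₗ[K] HCK K) ∘ₗ addRoot K = addRoot K :=
    linearMap_ext_forest fun F => by simp
  rw [comul_addRoot, map_add, LinearMap.lTensor_tmul, linPart_one, TensorProduct.tmul_zero,
    zero_add, ← LinearMap.comp_apply, ← LinearMap.lTensor_comp, h]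

theorem sum_antidiagonal_eq_sum_range {M : Type*} [AddCommMonoid M] (n : ℕ) (F : ℕ × ℕ → M) :
    ∑ p ∈ antidiagonal n, F p = ∑ k ∈ Finset.range (n + 1), F (n - k, k) := by
  rw [← Finset.Nat.sum_antidiagonal_swap, Finset.Nat.sum_antidiagonal_eq_sum_range_succ_mk]
  rfl

theorem sum_antidiagonal_add {M : Type*} [AddCommMonoid M] (d k : ℕ) (F : ℕ × ℕ → M)
    (hF : ∀ a, ∀ c < k, F (a, c) = 0) :
    ∑ p ∈ antidiagonal (d + k), F p = ∑ p ∈ antidiagonal d, F (p.1, p.2 + k) := by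
  induction k generalizing F with
  | zero => rfl
  | succ k ih =>
    rw [← add_assoc, Finset.Nat.antidiagonal_succ', Finset.sum_cons, Finset.sum_map,
      hF _ _ k.succ_pos, zero_add]
    have := ih (fun p => F (p.1, p.2 + 1)) fun a c hc => hF _ _ (by omega)
    refine Eq.trans ?_ (this.trans ?_)
    · rfl
    · exact Finset.sum_congr rfl fun p _ => by rw [add_assoc]

/-- A graded sequence of linear combinations of trees, generating a Hopf subalgebra, with a dual
family of functionals. The term of index `n` has degree `n + 1`. -/
structure DualSeq (T : ℕ → HCK K) (e : ℕ → RTree → K) : Prop where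
  mem_treeSpan : ∀ n, T n ∈ treeSpan K (n + 1)
  comul_mem : ∀ n, comul K (T n) ∈ (Algebra.TensorProduct.map
    (Algebra.adjoin K (Set.range T)).val (Algebra.adjoin K (Set.range T)).val).range
  dual_size : ∀ n (t : RTree), t.size ≠ n + 1 → e n t = 0
  dual_self : ∀ n, linPart (e n) (T n) = 1

theorem IsSeq.exists_dualSeq {t : ℕ+ → HCK K} (ht : IsSeq t) :
    ∃ e, DualSeq (fun n => t n.succPNat) e := by
  have hT : ∀ n : ℕ, t n.succPNat ∈ treeSpan K (n + 1) := fun n => ht.mem_span n.succPNat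
  choose e he1 he2 using fun n => exists_dual_of_mem_treeSpan (hT n) (ht.ne_zero _)
  have hr : Set.range (fun n : ℕ => t n.succPNat) = Set.range t := by
    ext y
    constructor
    · rintro ⟨n, rfl⟩
      exact ⟨_, rfl⟩
    · rintro ⟨n, rfl⟩
      exact ⟨n.natPred, by simp⟩
  refine ⟨e, hT, fun n => ?_, he1, he2⟩
  rw [hr]
  exact ht.hopf.1 _ (Algebra.subset_adjoin ⟨_, rfl⟩)

namespace DualSeq

variable {T : ℕ → HCK K} {e : ℕ → RTree → K}

theorem dual_ne (h : DualSeq T e) {m n : ℕ} (hmn : m ≠ n) : linPart (e m) (T n) = 0 :=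
  linPart_eq_zero_of_mem_forestSpan (treeSpan_le_forestSpan _ (h.mem_treeSpan n))
    fun t ht => h.dual_size m t (by omega)

theorem dual_apply (h : DualSeq T e) (m n : ℕ) :
    linPart (e m) (T n) = if m = n then 1 else 0 := by
  split_ifs with hmn
  · rw [hmn, h.dual_self]
  · exact h.dual_ne hmn

/-- The linear part of a polynomial in the T_k is a combination of the T_k, and the dual functionals
read off its coordinates. Stating this for all large N avoids tracking degree bounds. -/
theorem eventually_linPart_eq_sum (h : DualSeq T e) {a : HCK K}
    (ha : a ∈ Algebra.adjoin K (Set.range T)) :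
    ∀ᶠ N in Filter.atTop, linPart MvPolynomial.X a =
      ∑ k ∈ Finset.range N, linPart (e k) a • T k := by
  induction ha using Algebra.adjoin_induction with
  | mem x hx =>
    obtain ⟨n, rfl⟩ := hx
    filter_upwards [Filter.eventually_gt_atTop n] with N hN
    rw [linPart_X_of_mem_treeSpan (h.mem_treeSpan n)]
    simp [h.dual_apply, hN]
  | algebraMap r =>
    refine Filter.Eventually.of_forall fun N => ?_
    simp only [Algebra.algebraMap_eq_smul_one, map_smul, linPart_one, smul_zero, zero_smul,
      Finset.sum_const_zero]
  | add x y _ _ hx hy =>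
    filter_upwards [hx, hy] with N h1 h2
    simp only [map_add, h1, h2, add_smul, Finset.sum_add_distrib]
  | mul x y _ _ hx hy =>
    filter_upwards [hx, hy] with N h1 h2
    simp only [linPart_mul, h1, h2, add_smul, Finset.sum_add_distrib, Finset.smul_sum, smul_assoc]

theorem linPart_of_mem (h : DualSeq T e) {a : HCK K}
    (ha : a ∈ Algebra.adjoin K (Set.range T)) {n : ℕ} (hn : a ∈ forestSpan K (n + 1))
    {M : Type*} [AddCommGroup M] [Module K M] (d : RTree → M) :
    linPart d a = linPart (e n) a • linPart d (T n) := by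
  obtain ⟨N, hN, hNn⟩ := ((h.eventually_linPart_eq_sum ha).and
    (Filter.eventually_gt_atTop n)).exists
  rw [← linPart_linPart_X, hN, map_sum, Finset.sum_eq_single n, map_smul]
  · intro k _ hk
    rw [linPart_eq_zero_of_mem_forestSpan hn fun t ht => h.dual_size k t (by omega), zero_smul,
      map_zero]
  · intro hn'
    exact absurd (Finset.mem_range.2 hNn) hn'

/-- The coefficients of the coproducts of the sequence. -/
noncomputable def coeff (T : ℕ → HCK K) (e : ℕ → RTree → K) (n k : ℕ) : HCK K :=
  contractRight (linPart (e k)) (T (n + k))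

theorem coeff_mem (h : DualSeq T e) (n k : ℕ) :
    coeff T e n k ∈ Algebra.adjoin K (Set.range T) :=
  contractRight_mem_of_comul_mem (h.comul_mem _) _

theorem coeff_mem_forestSpan (h : DualSeq T e) (n k : ℕ) : coeff T e n k ∈ forestSpan K n :=
  contractRight_mem_forestSpan (h.dual_size k) (h.mem_treeSpan (n + k))

theorem contractRight_eq_zero_of_lt (h : DualSeq T e) {n k : ℕ} (hnk : n < k) :
    contractRight (linPart (e k)) (T n) = 0 :=
  contractRight_eq_zero (Nat.succ_lt_succ hnk) (h.dual_size k) (h.mem_treeSpan n)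

theorem coeff_zero (h : DualSeq T e) (k : ℕ) : coeff T e 0 k = 1 := by
  rw [eq_counit_of_mem_forestSpan_zero (h.coeff_mem_forestSpan 0 k), coeff,
    counit_contractRight, zero_add, h.dual_self, one_smul]

/-- The right factors of Δ T_n, apart from the term T_n ⊗ 1, are linear and come from the
subalgebra, hence expand in the T_k. Homogeneity removes the terms with k > n. -/
theorem comul_eq (h : DualSeq T e) (n : ℕ) : comul K (T n) = T n ⊗ₜ[K] 1 +
    ∑ p ∈ antidiagonal n, coeff T e p.1 p.2 ⊗ₜ[K] T p.2 := by
  set A := Algebra.adjoin K (Set.range T) with hA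
  have key : ∀ w : A ⊗[K] A, ∀ᶠ N in Filter.atTop,
      (linPart MvPolynomial.X).lTensor (HCK K) (Algebra.TensorProduct.map A.val A.val w) =
        ∑ k ∈ Finset.range N, (TensorProduct.rid K _ ((linPart (e k)).lTensor (HCK K)
          (Algebra.TensorProduct.map A.val A.val w))) ⊗ₜ[K] T k := by
    intro w
    induction w with
    | zero => simp
    | add a b ha hb =>
      filter_upwards [ha, hb] with N h1 h2
      simp only [map_add, h1, h2, TensorProduct.add_tmul, Finset.sum_add_distrib]
    | tmul a b =>
      filter_upwards [h.eventually_linPart_eq_sum b.2] with N hN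
      rw [Algebra.TensorProduct.map_tmul, LinearMap.lTensor_tmul]
      change _ ⊗ₜ[K] linPart MvPolynomial.X (b : HCK K) = _
      rw [hN, TensorProduct.tmul_sum]
      refine Finset.sum_congr rfl fun k _ => ?_
      simp [TensorProduct.smul_tmul]
  obtain ⟨w, hw⟩ := h.comul_mem n
  obtain ⟨N, hN, hNn⟩ := ((key w).and (Filter.eventually_gt_atTop n)).exists
  change Algebra.TensorProduct.map A.val A.val w = _ at hw
  rw [lTensor_linPart_comul_of_mem_treeSpan (h.mem_treeSpan n)]
  congr 1
  have hsum : ∑ p ∈ antidiagonal n, coeff T e p.1 p.2 ⊗ₜ[K] T p.2 =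
      ∑ k ∈ Finset.range (n + 1), coeff T e (n - k) k ⊗ₜ[K] T k :=
    sum_antidiagonal_eq_sum_range n _
  rw [← hw, hN, hw, hsum]
  simp only [← contractRight_apply]
  rw [← Finset.sum_subset (Finset.range_subset_range.2 (Nat.succ_le_of_lt hNn))]
  · refine Finset.sum_congr rfl fun k hk => ?_
    have hk := Finset.mem_range.1 hk
    rw [coeff, Nat.sub_add_cancel (by omega)]
  · intro k _ hk
    rw [h.contractRight_eq_zero_of_lt (by simpa using hk), TensorProduct.zero_tmul]

theorem contractLeft_eq (h : DualSeq T e) (f : HCK K →ₗ[K] K) (n : ℕ) :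
    contractLeft f (T n) = f (T n) • 1 +
      ∑ p ∈ antidiagonal n, f (coeff T e p.1 p.2) • T p.2 := by
  rw [contractLeft_apply, h.comul_eq]
  simp

/-- Coassociativity applied to `comul_eq`: contracting the right factor with the dual of T_k
replaces T_b by `coeff T e (b - k) k`, and by 0 if b < k. -/
theorem comul_coeff (h : DualSeq T e) (n k : ℕ) : comul K (coeff T e n k) =
    ∑ p ∈ antidiagonal n, coeff T e p.1 (p.2 + k) ⊗ₜ[K] coeff T e p.2 k := by
  have h1 : contractRight (linPart (e k)) 1 = 0 := by
    rw [contractRight_apply, map_one, Algebra.TensorProduct.one_def]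
    simp
  rw [coeff, comul_contractRight, h.comul_eq, map_add, map_sum, LinearMap.lTensor_tmul, h1,
    TensorProduct.tmul_zero, zero_add]
  exact sum_antidiagonal_add n k _ fun a c hc => by
    rw [LinearMap.lTensor_tmul, h.contractRight_eq_zero_of_lt hc, TensorProduct.tmul_zero]

theorem linPart_coeff_succ (h : DualSeq T e) {M : Type*} [AddCommGroup M] [Module K M]
    (d : RTree → M) (n k : ℕ) : linPart d (coeff T e (n + 1) k) =
      linPart (e n) (coeff T e (n + 1) k) • linPart d (T n) :=
  h.linPart_of_mem (h.coeff_mem _ _) (h.coeff_mem_forestSpan _ _) d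

theorem addRoot_coeff (h : DualSeq T e) (h0 : T 0 = MvPolynomial.X leaf) (n : ℕ) :
    addRoot K (coeff T e n 0) = T n := by
  classical
  -- The vertex is the only tree of size 1, so the normalisation on T_0 determines e_0, and
  -- contraction with it inverts B₊.
  have he : linPart (e 0) = leafPart K := by
    rw [leafPart]
    congr 1
    funext t
    by_cases ht : t = leaf
    · have := h.dual_self 0
      rw [h0, linPart_X] at this
      simp [ht, this]
    · rw [Pi.single_eq_of_ne ht]
      refine h.dual_size 0 t fun hs => ht ?_
      obtain ⟨F, rfl⟩ := node_surjective t
      rw [size_node] at hs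
      rw [eq_zero_of_sum_size_eq_zero (show (F.map RTree.size).sum = 0 by omega)]
      rfl
  obtain ⟨y, hy⟩ := exists_addRoot_eq_of_mem_treeSpan (h.mem_treeSpan n)
  rw [coeff, he, add_zero, ← hy, contractRight_leafPart_addRoot]

end DualSeq

/-! ## Strong sequences come from group-like sequences -/

/-- The f_m have the distinct positive degrees m + 1, so they are linearly independent modulo
constants. -/
theorem eq_zero_of_sum_mul_eq_C {f : ℕ → Polynomial K} {n : ℕ}
    (hf : ∀ m < n, (f m).coeff (m + 1) ≠ 0 ∧ ∀ j, m + 1 < j → (f m).coeff j = 0)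
    {g : ℕ → K} {c : K} (hs : ∑ m ∈ Finset.range n, Polynomial.C (g m) * f m = Polynomial.C c) :
    ∀ m < n, g m = 0 := by
  induction n with
  | zero => simp
  | succ n ih =>
    have hn : g n = 0 := by
      have h := congrArg (fun p => Polynomial.coeff p (n + 1)) hs
      simp only [Finset.sum_range_succ, Polynomial.coeff_add, Polynomial.finsetSum_coeff,
        Polynomial.coeff_C_mul, Polynomial.coeff_C_succ] at h
      rw [Finset.sum_eq_zero, zero_add] at h
      · exact (mul_eq_zero.1 h).resolve_right (hf n n.lt_succ_self).1
      · intro k hk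
        have hk := Finset.mem_range.1 hk
        rw [(hf k (by omega)).2 _ (by omega), mul_zero]
    intro m hm
    rcases Nat.lt_succ_iff_lt_or_eq.1 hm with h | rfl
    · refine ih (fun m hm => hf m (by omega)) ?_ m h
      rw [Finset.sum_range_succ, hn, map_zero, zero_mul, add_zero] at hs
      exact hs
    · exact hn

theorem SatisfiesRGE.derivative_eq {β : ℕ → PowerSeries K} {γ₀ : PowerSeries K}
    {φ : HCK K →ₐ[K] Polynomial K} {t : ℕ+ → HCK K} (h : SatisfiesRGE 0 β γ₀ (green φ t)) (n : ℕ) :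
    Polynomial.derivative (φ (t n.succPNat)) =
      Polynomial.C (PowerSeries.coeff (n + 1) (β 0) + PowerSeries.coeff (n + 1) γ₀) +
        ∑ p ∈ antidiagonal n, Polynomial.C (PowerSeries.coeff p.1 (β 0)) *
          φ (t p.2.succPNat) := by
  have h2 := congrArg (PowerSeries.coeff (n + 1)) h.2
  rw [zero_add, Finset.sum_range_one, Function.iterate_zero, id, derivL, PowerSeries.coeff_mk,
    map_add, PowerSeries.coeff_mul, Finset.Nat.antidiagonal_succ', Finset.sum_cons,
    Finset.sum_map] at h2
  have hmap : ∀ p : ℕ × ℕ, (Function.Embedding.refl ℕ).prodMap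
      ⟨Nat.succ, Nat.succ_injective⟩ p = (p.1, p.2 + 1) := fun _ => rfl
  simp only [hmap, constL, PowerSeries.coeff_map, PowerSeries.coeff_mk, green, Nat.succ_pos,
    dif_pos, lt_irrefl, dif_neg, not_false_eq_true, mul_one] at h2
  rw [map_add]
  refine h2.trans ?_
  rw [add_right_comm]
  rfl

/-- One well-chosen φ suffices. The derivative of φ(T_n) is computed once from the coproduct, with
coefficients depending on n - k and k, and once from the equation, with coefficients depending only
on n - k. Independence of the φ(T_k) identifies the two. -/
theorem DualSeq.exists_linPart_coeff_eq [CharZero K] {t : ℕ+ → HCK K} {e : ℕ → RTree → K}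
    (h : DualSeq (fun n => t n.succPNat) e) (ht : IsStrong 0 t) :
    ∃ lam : ℕ → K, lam 1 ≠ 0 ∧ ∀ n k,
      linPart (e n) (coeff (fun n => t n.succPNat) e (n + 1) k) = lam (n + 1) := by
  set T : ℕ → HCK K := fun n => t n.succPNat with hT
  -- The dual functionals are glued degree by degree, so that one generator takes the value 1 on
  -- every T_n.
  set d : RTree → K := fun s => e (s.size - 1) s with hd
  have hdT : ∀ n, linPart d (T n) = 1 := by
    intro n
    rw [← h.dual_self n]
    refine linPart_congr_of_mem_forestSpan (treeSpan_le_forestSpan _ (h.mem_treeSpan n))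
      fun s hs => ?_
    rw [hd]
    simp only [hs, Nat.add_sub_cancel]
  obtain ⟨β, γ, hRGE, hβ⟩ := ht.2 (feynman d) (isFeynmanRules_feynman d)
  set B : ℕ → K := fun n => PowerSeries.coeff n (β 0) with hB
  set f : ℕ → Polynomial K := fun n => feynman d (T n) with hf
  set μ : ℕ → ℕ → K := fun a b => linPart d (coeff T e a b) with hμ
  have hμ0 : ∀ b, μ 0 b = 0 := fun b => by rw [hμ]; simp only [h.coeff_zero, linPart_one]
  have hB0 : B 0 = 0 := by
    have := hRGE.1 0 le_rfl
    rw [zero_add, pow_one, PowerSeries.X_dvd_iff] at this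
    exact (PowerSeries.coeff_zero_eq_constantCoeff_apply _).trans this
  have h1 : ∀ n, Polynomial.derivative (f n) = 1 +
      ∑ k ∈ Finset.range n, Polynomial.C (μ (n - k) k) * f k := by
    intro n
    rw [hf]
    simp only
    rw [derivative_feynman, h.contractLeft_eq, map_add, map_smul, map_one, hdT, one_smul, map_sum,
      sum_antidiagonal_eq_sum_range, Finset.sum_range_succ, Nat.sub_self]
    simp only [map_smul, Polynomial.smul_eq_C_mul]
    rw [show linPart d (coeff T e 0 n) = 0 from hμ0 n, map_zero, zero_mul, add_zero]
  have h2 : ∀ n, Polynomial.derivative (f n) = Polynomial.C (B (n + 1) +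
      PowerSeries.coeff (n + 1) γ) + ∑ k ∈ Finset.range n, Polynomial.C (B (n - k)) * f k := by
    intro n
    refine (hRGE.derivative_eq n).trans ?_
    rw [sum_antidiagonal_eq_sum_range, Finset.sum_range_succ, Nat.sub_self]
    rw [show PowerSeries.coeff 0 (β 0) = 0 from hB0, map_zero, zero_mul, add_zero]
  -- For these Feynman rules the image of the vertex has derivative 1, so it is nonzero and the
  -- condition on β_1 applies.
  have hB1 : B 1 ≠ 0 := by
    refine hβ fun h0 => ?_
    have := h1 0
    have hT0 : T 0 = MvPolynomial.X leaf := ht.1.one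
    rw [hf] at this
    simp only [hT0, h0] at this
    simp at this
  -- Degrees and coefficients are treated in one induction: the comparison needs the exact degrees
  -- of the earlier f_k, and the leading coefficient of f_n is then B_1/(n + 1) times that of
  -- f_{n-1}.
  have key : ∀ n, ((f n).coeff (n + 1) ≠ 0 ∧ ∀ j, n + 1 < j → (f n).coeff j = 0) ∧
      ∀ k < n, μ (n - k) k = B (n - k) := by
    intro n
    induction n using Nat.strong_induction_on with
    | _ n ih =>
      have hμB : ∀ k < n, μ (n - k) k = B (n - k) := by
        have hsub : ∑ k ∈ Finset.range n, Polynomial.C (μ (n - k) k - B (n - k)) * f k =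
            Polynomial.C (B (n + 1) + PowerSeries.coeff (n + 1) γ - 1) := by
          have := (h1 n).symm.trans (h2 n)
          simp only [map_sub, sub_mul, Finset.sum_sub_distrib, Polynomial.C_1]
          linear_combination this
        intro k hk
        exact sub_eq_zero.1 (eq_zero_of_sum_mul_eq_C (fun m hm => (ih m hm).1) hsub k hk)
      refine ⟨?_, hμB⟩
      have hcoeff : ∀ j, (f n).coeff (j + 1) * (j + 1) = (1 : Polynomial K).coeff j +
          ∑ k ∈ Finset.range n, μ (n - k) k * (f k).coeff j := by
        intro j
        rw [← Polynomial.coeff_derivative, h1]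
        simp
      constructor
      · have := hcoeff n
        intro h0
        rw [h0, zero_mul] at this
        cases n with
        | zero => simp at this
        | succ n =>
          rw [Finset.sum_range_succ, Finset.sum_eq_zero, zero_add, hμB n n.lt_succ_self,
            Nat.add_sub_cancel_left, Polynomial.coeff_one, if_neg n.succ_ne_zero, zero_add] at this
          · exact mul_ne_zero hB1 (ih n n.lt_succ_self).1.1 this.symm
          · intro k hk
            have hk := Finset.mem_range.1 hk
            rw [(ih k (by omega)).1.2 _ (by omega), mul_zero]
      · intro j hj
        obtain ⟨j, rfl⟩ := Nat.exists_eq_succ_of_ne_zero (show j ≠ 0 by omega)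
        have := hcoeff j
        rw [Polynomial.coeff_one, if_neg (by omega), Finset.sum_eq_zero, zero_add] at this
        · have hj0 : (j : K) + 1 ≠ 0 := by exact_mod_cast j.succ_ne_zero
          exact (mul_eq_zero.1 this).resolve_right hj0
        · intro k hk
          have hk := Finset.mem_range.1 hk
          rw [(ih k hk).1.2 _ (by omega), mul_zero]
  refine ⟨B, hB1, fun n k => ?_⟩
  have h3 := h.linPart_coeff_succ d n k
  rw [hdT, smul_eq_mul, mul_one] at h3
  rw [← h3]
  have := (key (n + 1 + k)).2 k (by omega)
  rwa [Nat.add_sub_cancel] at this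

namespace DualSeq

variable {T : ℕ → HCK K} {e : ℕ → RTree → K}

/-- The bracket of e_i and e_j is evaluated on `coeff T e (i + j + 2) 0` in two ways. Via
`comul_coeff` both composites give λ_{i+1} λ_{j+1}, so it vanishes. Being an infinitesimal
character, it sees only the linear part λ_{i+j+2} T_{i+j+1}, on which it equals λ_{i+j+2}(λ_{i+1} -
λ_{j+1}). -/
theorem sub_mul_eq_zero (h : DualSeq T e) {lam : ℕ → K}
    (hlam : ∀ n k, linPart (e n) (coeff T e (n + 1) k) = lam (n + 1)) (i j : ℕ) :
    (lam (i + 1) - lam (j + 1)) * lam (i + j + 2) = 0 := by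
  have h1 : ∀ i j k, linPart (e i) (coeff T e (j + 1) k) = if i = j then lam (j + 1) else 0 := by
    intro i j k
    rw [h.linPart_coeff_succ, hlam, h.dual_apply]
    split_ifs <;> simp
  have h2 : ∀ i j, linPart (e i) (contractRight (linPart (e j)) (coeff T e (i + j + 2) 0)) =
      lam (i + 1) * lam (j + 1) := by
    intro i j
    rw [contractRight_apply, h.comul_coeff, map_sum, map_sum, map_sum,
      Finset.sum_eq_single (i + 1, j + 1)]
    · simp [hlam, mul_comm]
    · rintro ⟨a, b⟩ hp hne
      have hp : a + b = i + j + 2 := mem_antidiagonal.1 hp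
      cases b with
      | zero => simp [h.coeff_zero]
      | succ b =>
        rw [LinearMap.lTensor_tmul, h1, if_neg]
        · simp
        · rintro rfl
          exact hne (Prod.ext (by simp only; omega) rfl)
    · intro hn
      exact absurd (mem_antidiagonal.2 (by simp only; omega)) hn
  have h3 : ∀ i j, linPart (e i) (contractRight (linPart (e j)) (T (i + j + 1))) =
      lam (i + 1) := by
    intro i j
    rw [← hlam i j, coeff, add_right_comm]
  have h4 : bracket (e i) (e j) (coeff T e (i + j + 2) 0) = 0 := by
    rw [bracket_apply, h2, show i + j + 2 = j + i + 2 by omega, h2]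
    ring
  rw [bracket_eq_linPart, h.linPart_coeff_succ, hlam, ← bracket_eq_linPart, bracket_apply, h3,
    show i + j + 1 = j + i + 1 by omega, h3, smul_eq_mul, mul_comm] at h4
  rwa [show i + j + 2 = j + i + 1 + 1 by omega]

/-- By induction on n the intermediate terms of the two coproducts agree, so the difference is
primitive. The linear parts satisfy the same recursion, because B₊ of the degree n coefficient is
T_n. -/
theorem coeff_eq_of_linPart [CharZero K] (h : DualSeq T e) (h0 : T 0 = MvPolynomial.X leaf)
    {lam : ℕ → K} (hlam : ∀ n k, linPart (e n) (coeff T e (n + 1) k) = lam (n + 1))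
    {x : ℕ → HCK K} (hx : IsGroupLikeSeq x)
    (hxlam : ∀ n (d : RTree → K), linPart d (x (n + 1)) =
      lam (n + 1) • linPart d (addRoot K (x n))) (n k : ℕ) : coeff T e n k = x n := by
  induction n using Nat.strong_induction_on generalizing k with
  | _ n ih =>
    cases n with
    | zero => rw [h.coeff_zero, hx.zero]
    | succ n =>
      rw [← sub_eq_zero]
      refine eq_zero_of_primitive_of_linPart_eq_zero ?_ fun d => ?_
      · have hl : (n + 1, 0) ∈ antidiagonal (n + 1) := mem_antidiagonal.2 rfl
        have hr : (0, n + 1) ∈ antidiagonal (n + 1) := mem_antidiagonal.2 (zero_add _)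
        rw [map_sub, h.comul_coeff, hx.comul, ← Finset.sum_sub_distrib,
          Finset.sum_eq_add_of_mem _ _ hl hr (by simp)]
        · simp only [h.coeff_zero, hx.zero, zero_add, TensorProduct.sub_tmul,
            TensorProduct.tmul_sub]
        · rintro ⟨a, b⟩ hp ⟨hne1, hne2⟩
          have hp : a + b = n + 1 := mem_antidiagonal.1 hp
          have ha : a < n + 1 := by
            by_contra hcon
            exact hne1 (Prod.ext (by simp only; omega) (by simp only; omega))
          have hb : b < n + 1 := by
            by_contra hcon
            exact hne2 (Prod.ext (by simp only; omega) (by simp only; omega))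
          rw [ih a ha, ih b hb, sub_self]
      · rw [map_sub, h.linPart_coeff_succ, hlam, hxlam, ← ih n n.lt_succ_self 0,
          h.addRoot_coeff h0, sub_self]

end DualSeq

theorem eq_of_dualSeq [CharZero K] {t : ℕ+ → HCK K} {e : ℕ → RTree → K}
    (h : DualSeq (fun n => t n.succPNat) e) (h0 : t 1 = MvPolynomial.X leaf) {lam : ℕ → K}
    (hlam : ∀ n k, linPart (e n) (DualSeq.coeff (fun n => t n.succPNat) e (n + 1) k) = lam (n + 1))
    {x : ℕ → HCK K} (hx : IsGroupLikeSeq x)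
    (hxlam : ∀ n (d : RTree → K), linPart d (x (n + 1)) =
      lam (n + 1) • linPart d (addRoot K (x n))) :
    t = fun n : ℕ+ => addRoot K (x ((n : ℕ) - 1)) := by
  funext n
  have h1 := h.coeff_eq_of_linPart h0 hlam hx hxlam n.natPred 0
  have h2 := h.addRoot_coeff h0 n.natPred
  rw [h1] at h2
  simp only [PNat.succPNat_natPred] at h2
  exact h2.symm

/-! ## Classification of the coefficients -/

/-- The sequence `(1, …, 1, b, 0, …)` with `b` at position `n`. -/
def truncSeq (n : ℕ) (b : K) (k : ℕ) : K := if k < n then 1 else if k = n then b else 0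

theorem eq_const_or_truncSeq {lam : ℕ → K} (h1 : lam 1 ≠ 0)
    (h : ∀ i j, (lam (i + 1) - lam (j + 1)) * lam (i + j + 2) = 0) :
    (∀ k, lam (k + 1) = lam 1) ∨ ∃ (n : ℕ) (b : K), 2 ≤ n ∧ b ≠ 1 ∧
      ∀ k, lam (k + 1) = lam 1 * truncSeq n b (k + 1) := by
  by_cases hall : ∀ k, lam (k + 1) = lam 1
  · exact Or.inl hall
  right
  push Not at hall
  classical
  set m := Nat.find hall with hm
  have hm1 : lam (m + 1) ≠ lam 1 := Nat.find_spec hall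
  have hlt : ∀ k < m, lam (k + 1) = lam 1 := fun k hk => by
    by_contra hcon
    exact Nat.find_min hall hk hcon
  have hm0 : m ≠ 0 := fun h0 => hm1 (by rw [h0])
  -- The relation with second index 1 propagates: any value different from `lam 1` is followed by 0,
  -- and 0 differs from `lam 1`.
  have hgt : ∀ k, lam (m + k + 2) = 0 := by
    intro k
    induction k with
    | zero =>
      refine (mul_eq_zero.1 (h m 0)).resolve_left ?_
      rw [zero_add]
      exact sub_ne_zero.2 hm1
    | succ k ih =>
      refine (mul_eq_zero.1 ((congrArg (_ * lam ·) (by omega)).trans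
        (h (m + k + 1) 0))).resolve_left ?_
      rw [show m + k + 1 + 1 = m + k + 2 by omega, ih, zero_add, zero_sub]
      exact neg_ne_zero.2 h1
  refine ⟨m + 1, lam (m + 1) / lam 1, by omega, fun hb => hm1 ?_, fun k => ?_⟩
  · rwa [div_eq_one_iff_eq h1] at hb
  · rw [truncSeq]
    split_ifs with h2 h3
    · rw [hlt k (by omega), mul_one]
    · rw [h3, mul_div_cancel₀ _ h1]
    · obtain ⟨j, rfl⟩ : ∃ j, k = m + j + 1 := ⟨k - m - 1, by omega⟩
      rw [mul_zero]
      exact hgt j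

theorem sub_mul_truncSeq_eq_zero {n : ℕ} {b : K} (i j : ℕ) :
    (truncSeq n b (i + 1) - truncSeq n b (j + 1)) * truncSeq n b (i + j + 2) = 0 := by
  simp only [truncSeq]
  split_ifs <;> first | omega | simp

theorem linPart_rescale_ladder (c : K) (n : ℕ) (d : RTree → K) :
    linPart d (c ^ (n + 1) • ladder K (n + 1)) =
      c • linPart d (addRoot K (c ^ n • ladder K n)) := by
  rw [ladder, map_smul, map_smul, map_smul, smul_smul, pow_succ']

theorem linPart_rescale_zComponent [CharZero K] (n : ℕ+) (b c : K) (k : ℕ) (d : RTree → K) :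
    linPart d (c ^ (k + 1) • zComponent n b (k + 1)) =
      (c * truncSeq n b (k + 1)) • linPart d (addRoot K (c ^ k • zComponent n b k)) := by
  rw [map_smul, linPart_zComponent n b k.succ_ne_zero, ← truncSeq]
  -- For k < n the degree k component is a ladder, so B₊ yields the next ladder; for k ≥ n the next
  -- linear part vanishes.
  by_cases hk : k < n
  · rw [zComponent_eq_ladder n b hk, map_smul, map_smul, ladder, smul_smul, smul_smul, pow_succ']
    congr 1
    ring
  · have : truncSeq n b (k + 1) = 0 := by
      rw [truncSeq, if_neg (by omega), if_neg (by omega)]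
    rw [this, mul_zero, zero_smul, zero_smul, smul_zero]

theorem rescaleSeq_addRoot (α : K) (x : ℕ → HCK K) :
    rescaleSeq α (fun n : ℕ+ => addRoot K (x ((n : ℕ) - 1))) =
      fun n : ℕ+ => addRoot K (α ^ ((n : ℕ) - 1) • x ((n : ℕ) - 1)) := by
  funext n
  rw [rescaleSeq, map_smul]

theorem isStrong_zero_iff [CharZero K] (t : ℕ+ → HCK K) : IsStrong 0 t ↔ ∃ α : K, α ≠ 0 ∧
    (t = rescaleSeq α (fun n => ladder K n) ∨
      ∃ (n : ℕ+) (b : K), b ≠ 0 ∧ t = rescaleSeq α (zSeq n b)) := by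
  constructor
  · intro ht
    obtain ⟨e, he⟩ := ht.1.exists_dualSeq
    obtain ⟨lam, h1, hlam⟩ := he.exists_linPart_coeff_eq ht
    have hz : ∀ (n : ℕ+) (b : K), (∀ k, lam (k + 1) = lam 1 * truncSeq n b (k + 1)) →
        t = rescaleSeq (lam 1) (zSeq n b) := by
      intro n b hb
      rw [zSeq_eq, rescaleSeq_addRoot]
      refine eq_of_dualSeq (x := fun k => lam 1 ^ k • zComponent n b k) he ht.1.one hlam
        ((zComponent_isGroupLikeSeq n b).rescale _) fun k d => ?_
      rw [hb k]
      exact linPart_rescale_zComponent n b (lam 1) k d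
    refine ⟨lam 1, h1, ?_⟩
    rcases eq_const_or_truncSeq h1 (he.sub_mul_eq_zero hlam) with hc | ⟨n, b, hn, -, hb⟩
    · left
      rw [ladder_eq_addRoot, rescaleSeq_addRoot]
      refine eq_of_dualSeq (x := fun k => lam 1 ^ k • ladder K k) he ht.1.one hlam
        (ladder_isGroupLikeSeq.rescale _) fun k d => ?_
      rw [hc k]
      exact linPart_rescale_ladder (lam 1) k d
    · right
      -- Truncation at n with last value 0 is truncation at n - 1 with last value 1; n ≥ 2 keeps the
      -- index positive.
      by_cases hb0 : b = 0
      · refine ⟨⟨n - 1, by omega⟩, 1, one_ne_zero, hz _ _ fun k => ?_⟩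
        rw [hb, hb0, truncSeq, truncSeq, PNat.mk_coe]
        congr 1
        split_ifs <;> first | rfl | omega
      · exact ⟨⟨n, by omega⟩, b, hb0, hz _ _ hb⟩
  · rintro ⟨α, hα, rfl | ⟨n, b, hb, rfl⟩⟩
    · exact isStrong_rescaleSeq_ladder hα
    · exact isStrong_rescaleSeq_zSeq n b hb hα

/-! ### Arrays that are constant in the first index -/

theorem isLambdaArray_const_iff {c : ℕ → K} :
    IsLambdaArray (fun _ j : ℕ+ => c j) ↔
      c 1 ≠ 0 ∧ ∀ i j, (c (i + 1) - c (j + 1)) * c (i + j + 2) = 0 := by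
  constructor
  · intro h
    constructor
    · obtain ⟨i, j, hij, hne⟩ := h.nondegenerate 2 le_rfl
      have h2 : (i : ℕ) + j = 2 := congrArg PNat.val hij
      have := i.pos
      have := j.pos
      rwa [show (j : ℕ) = 1 by omega] at hne
    · intro i j
      -- The first index is arbitrary. The products c_j c_k on both sides cancel, leaving (c_j -
      -- c_k) c_{j+k} = 0.
      have := h.preLie 1 i.succPNat j.succPNat
      rw [PNat.add_coe, Nat.succPNat_coe, Nat.succPNat_coe,
        show i.succ + j.succ = i + j + 2 by omega] at this
      linear_combination this
  · rintro ⟨h1, h⟩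
    refine ⟨fun i j k => ?_, fun n hn => ?_⟩
    · have := h j.natPred k.natPred
      have hj := j.natPred_add_one
      have hk := k.natPred_add_one
      rw [show j.natPred + k.natPred + 2 = (j : ℕ) + k by omega, hj, hk] at this
      simp only [PNat.add_coe]
      linear_combination this
    · have hn' : 1 < n := hn
      exact ⟨n - 1, 1, PNat.sub_add_of_lt hn', h1⟩

theorem isLambdaArray_and_const_iff (lam : ℕ+ → ℕ+ → K) :
    (IsLambdaArray lam ∧ ∀ j i i' : ℕ+, lam i j = lam i' j) ↔
      ∃ c : K, c ≠ 0 ∧ ((∀ i j, lam i j = c) ∨ ∃ (n : ℕ+) (b : K), 2 ≤ n ∧ b ≠ 1 ∧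
        ∀ i j, lam i j = c * (if j < n then 1 else if j = n then b else 0)) := by
  constructor
  · rintro ⟨h, hconst⟩
    obtain ⟨s, hs⟩ : ∃ s : ℕ → K, ∀ i j : ℕ+, lam i j = s j :=
      ⟨fun j => lam 1 j.toPNat', fun i j => by simp [hconst j i 1]⟩
    obtain rfl : lam = fun _ j : ℕ+ => s j := funext fun i => funext fun j => hs i j
    obtain ⟨h1, h2⟩ := isLambdaArray_const_iff.1 h
    refine ⟨s 1, h1, ?_⟩
    rcases eq_const_or_truncSeq h1 h2 with hc | ⟨n, b, hn, hb, hc⟩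
    · exact Or.inl fun i j => by rw [hs i, ← j.natPred_add_one, hc]
    · obtain ⟨n, rfl⟩ : ∃ m : ℕ+, (m : ℕ) = n := ⟨⟨n, by omega⟩, rfl⟩
      refine Or.inr ⟨n, b, hn, hb, fun i j => ?_⟩
      rw [hs i, ← j.natPred_add_one, hc, truncSeq, j.natPred_add_one]
      simp only [← PNat.coe_lt_coe, ← PNat.coe_inj]
  · rintro ⟨c, hc, h | ⟨n, b, hn, hb, h⟩⟩
    · obtain rfl : lam = fun _ _ => c := funext fun i => funext fun j => h i j
      exact ⟨(isLambdaArray_const_iff (c := fun _ => c)).2 ⟨hc, by simp⟩, fun _ _ _ => rfl⟩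
    · obtain rfl : lam = fun _ j : ℕ+ => c * truncSeq n b j := by
        funext i j
        rw [h, truncSeq]
        simp only [← PNat.coe_lt_coe, ← PNat.coe_inj]
      refine ⟨(isLambdaArray_const_iff (c := fun j => c * truncSeq n b j)).2 ⟨?_, fun i j => ?_⟩,
        fun _ _ _ => rfl⟩
      · have hn' : 1 < (n : ℕ) := hn
        simpa [truncSeq, hn'] using hc
      · have := sub_mul_truncSeq_eq_zero (n := n) (b := b) i j
        linear_combination c ^ 2 * this

end CK

theorem mainTheorem4 {K : Type*} [Field K] [CharZero K] :
    (∀ t : ℕ+ → CK.HCK K, CK.IsStrong 0 t ↔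
      ∃ α : K, α ≠ 0 ∧
        (t = CK.rescaleSeq α (fun n => CK.ladder K n) ∨
          ∃ (n : ℕ+) (b : K), b ≠ 0 ∧ t = CK.rescaleSeq α (CK.zSeq n b))) ∧
    (∀ lam : ℕ+ → ℕ+ → K,
      (CK.IsLambdaArray lam ∧ ∀ j i i' : ℕ+, lam i j = lam i' j) ↔
        ∃ c : K, c ≠ 0 ∧
          ((∀ i j, lam i j = c) ∨
            ∃ (n : ℕ+) (b : K), 2 ≤ n ∧ b ≠ 1 ∧
              ∀ i j, lam i j = c * (if j < n then 1 else if j = n then b else 0))) :=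
  ⟨CK.isStrong_zero_iff, CK.isLambdaArray_and_const_iff⟩
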